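/- **The scheme.** For a security parameter $\kappa$ there are $n=n(\kappa)$ users ($n$ polynomially bounded) and one aggregator. A probabilistic polynomial-time (PPT) algorithm $\mathrm{Setup}(1^\kappa)$ outputs public parameters: an RSA modulus $N$ (a product of two distinct primes), a positive integer $q$, and the description of a polynomial-time computable hash function $H$ from times $t$ to $(\mathbb Z/N^2)^\times$. Times are natural numbers of polynomially many bits. In $\mathrm{KeyGen}$ every user $\nu$ chooses $s_{\nu,\mu}\in\{0,\dots,q-1\}$ uniformly and independently for every other user $\mu$ ($s_{\nu,\nu}=0$) and sends it to $\mu$ over a secure channel; the secret key of $\nu$ is $p_\nu=\sum_\mu (s_{\nu,\mu}-s_{\mu,\nu})\in\mathbb Z$. To mask an integer $x_\nu$ at time $t$, user $\nu$ publishes $y_\nu=(1+N)^{x_\nu}H(t)^{p_\nu} \bmod N^2$ on an open channel. The aggregator computes $\big((\prod_\nu y_\nu-1) \bmod N^2\big)/N \bmod N$, which is $\sum_\nu x_\nu \bmod N$. **IND-CPA masking.** Adversaries and distinguishers are non-uniform PPT algorithms. Let $T_1,T_2,T_c$ be pairwise disjoint time domains (sets of times, one for each $\kappa$, recognizable in polynomial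 time with polynomial advice). In the data publishing game the adversary declares a coalition of $O(\log\kappa)$ parties; $\mathrm{Setup}$ and $\mathrm{KeyGen}$ are run, and it receives the public parameters and the random numbers chosen and received by the users of its coalition. It then makes polynomially many adaptive queries $(t,(x_\nu)_\nu)$ with pairwise distinct $t\in T_1$, each answered by all the masked values; submits a challenge $t_c\in T_c$, $(x_{\nu,0})_\nu$, $(x_{\nu,1})_\nu$ with $\sum_\nu x_{\nu,0}=\sum_\nu x_{\nu,1}$ and $x_{\nu,0}=x_{\nu,1}$ for the users in its own coalition, and receives the masked values of $(x_{\nu,b})_\nu$ at time $t_c$ for a uniformly random bit $b$; makes further queries with pairwise distinct $t\in T_2$; and outputs a guess $b'$. The masking is IND-CPA if for all such $T_1,T_2,T_c$ and every such adversary, $\left|\Pr[b'=b]-\tfrac12\right|$ is negligible in $\kappa$. **Theorem.** Assume that the random masking of the Feddy scheme is IND-CPA. Let $C=(C_\kappa)_\kappa$ be sets of parties (users, possibly also the aggregator) with $|C_\kappa|=O(\log\kappa)$, controlled by a semi-honest adversary. Then Feddy privately computes the class of summation functions: for every polynomially bounded $\ell$ and the function $f(x_1,\dots,x_n)=\sum_\nu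 x_\nu$ on integers with $|x_\nu|<2^{\ell(\kappa)}$, there is a (uniform) PPT simulator $\mathcal S$ such that for all inputs $X=(x_1,\dots,x_n)$ in the domain of $f$ and every time $t$ (both may depend on $\kappa$), $$\{\mathcal S(1^\kappa,t,f(X),C,(x_\nu)_{\nu\in C})\}_\kappa\ \overset{c}{\equiv}\ \{\mathrm{View}_C(X)\}_\kappa ,$$ where $\overset{c}{\equiv}$ is computational indistinguishability. $\mathrm{View}_C(X)$ is everything the coalition sees when all parties follow the protocol on input $X$ at time $t$: $t$, $C$, its inputs, the public parameters, the random numbers chosen and received by its users in $\mathrm{KeyGen}$, and all the published values $y_1,\dots,y_n$. -/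

import Mathlib

open Filter Asymptotics

noncomputable section

namespace Feddy

/-! Data and a programming language with a step count -/

/-- Data handled by algorithms: binary trees whose leaves are natural numbers (in binary). -/
inductive Val : Type
  | num (n : ℕ) : Val
  | pair (a b : Val) : Val

namespace Val

/-- The length of a datum, in bits up to a constant factor. -/
def size : Val → ℕ
  | num n => Nat.size n + 1
  | pair a b => a.size + b.size + 1

def fst : Val → Val
  | pair a _ => a
  | num _ => num 0

def snd : Val → Val
  | pair _ b => b
  | num _ => num 0

def toNat : Val → ℕ
  | num n => n
  | pair _ _ => 0

/-- Integers, as a sign and an absolute value. -/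
def ofInt (x : ℤ) : Val := pair (num (if x < 0 then 1 else 0)) (num x.natAbs)

def toInt (v : Val) : ℤ :=
  if v.fst.toNat = 0 then (v.snd.toNat : ℤ) else -(v.snd.toNat : ℤ)

/-- Lists, as iterated pairs ended by `0`. -/
def ofList : List Val → Val
  | [] => num 0
  | a :: l => pair a (ofList l)

/-- The `i`-th entry of an encoded list. -/
def entry : ℕ → Val → Val
  | 0, v => v.fst
  | i + 1, v => entry i v.snd

/-- Tuples, as lists. -/
def ofTuple {n : ℕ} (g : Fin n → Val) : Val := ofList (List.ofFn g)

end Val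

/-- Basic instructions: projections, integer arithmetic, comparison, a type test. -/
inductive Op : Type
  | id | fst | snd | add | sub | mul | div | mod | lt | isPair

/-- The effect of an instruction (the result is `0` on an argument of the wrong shape). -/
def Op.apply : Op → Val → Val
  | .id, v => v
  | .fst, v => v.fst
  | .snd, v => v.snd
  | .add, .pair (.num a) (.num b) => .num (a + b)
  | .sub, .pair (.num a) (.num b) => .num (a - b)
  | .mul, .pair (.num a) (.num b) => .num (a * b)
  | .div, .pair (.num a) (.num b) => .num (a / b)
  | .mod, .pair (.num a) (.num b) => .num (a % b)
  | .lt, .pair (.num a) (.num b) => .num (if a < b then 1 else 0)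
  | .isPair, .pair _ _ => .num 1
  | _, _ => .num 0

/-- While-programs over `Val`. -/
inductive Prog : Type
  | op (o : Op) : Prog
  | const (c : Val) : Prog
  | pair (p q : Prog) : Prog
  | comp (p q : Prog) : Prog
  | ite (c p q : Prog) : Prog
  | loop (c p : Prog) : Prog

/-- `Runs p v w t`: on input `v` the program `p` halts with output `w` after `t` steps.
A basic instruction is charged the square of the length of its argument (the bit cost of
schoolbook arithmetic), and every copy of a datum is charged its length. -/
inductive Runs : Prog → Val → Val → ℕ → Prop
  | op (o : Op) (v : Val) : Runs (.op o) v (o.apply v) ((v.size + 1) ^ 2)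
  | const (c v : Val) : Runs (.const c) v c (c.size + 1)
  | pair {p q : Prog} {v a b : Val} {s t : ℕ} :
      Runs p v a s → Runs q v b t → Runs (.pair p q) v (.pair a b) (s + t + v.size + 1)
  | comp {p q : Prog} {v a b : Val} {s t : ℕ} :
      Runs p v a s → Runs q a b t → Runs (.comp p q) v b (s + t + 1)
  | ite_true {c p q : Prog} {v a b : Val} {r s : ℕ} :
      Runs c v a r → a ≠ .num 0 → Runs p v b s → Runs (.ite c p q) v b (r + s + v.size + 1)
  | ite_false {c p q : Prog} {v b : Val} {r s : ℕ} :
      Runs c v (.num 0) r → Runs q v b s → Runs (.ite c p q) v b (r + s + v.size + 1)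
  | loop_done {c p : Prog} {v : Val} {r : ℕ} :
      Runs c v (.num 0) r → Runs (.loop c p) v v (r + v.size + 1)
  | loop_step {c p : Prog} {v a w u : Val} {r s t : ℕ} :
      Runs c v a r → a ≠ .num 0 → Runs p v w s → Runs (.loop c p) w u t →
      Runs (.loop c p) v u (r + s + t + v.size + 1)

/-- `f` is computed by a program in time polynomial in the length of the input. -/
def PolyTime (f : Val → Val) : Prop :=
  ∃ (p : Prog) (P : Polynomial ℕ), ∀ v, ∃ t ≤ P.eval v.size, Runs p v (f v) t

/-- Polynomially bounded functions of the security parameter. -/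
def PolyBounded (g : ℕ → ℕ) : Prop := ∃ P : Polynomial ℕ, ∀ κ, g κ ≤ P.eval κ

/-- Negligible functions of the security parameter. -/
def Negligible (g : ℕ → ℝ) : Prop := SuperpolynomialDecay atTop (fun κ : ℕ => (κ : ℝ)) g

/-- The string `1^κ`; as a binary number, `1` followed by `κ` zeros. -/
def secParam (κ : ℕ) : Val := .num (2 ^ κ)

/-! Probabilistic polynomial time and computational indistinguishability -/

/-- A probabilistic polynomial-time algorithm. With security parameter `κ` it tosses
`coins.eval κ` fair coins; `run` is given `1^κ`, the tape of coins, and the input. -/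
structure PPT where
  run : Val → Val
  polyTime : PolyTime run
  coins : Polynomial ℕ

def PPT.output (S : PPT) (κ : ℕ) (r : Fin (2 ^ S.coins.eval κ)) (v : Val) : Val :=
  S.run (.pair (secParam κ) (.pair (.num r) v))

/-- The output distribution of an algorithm. -/
def PPT.dist (S : PPT) (κ : ℕ) (v : Val) : PMF Val :=
  (PMF.uniformOfFintype (Fin (2 ^ S.coins.eval κ))).map fun r => S.output κ r v

/-- A non-uniform probabilistic polynomial-time algorithm: it also receives an advice string
of polynomial length, which depends on `κ` only. -/
structure NonuniformPPT extends PPT where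
  advice : ℕ → Val
  advice_bounded : PolyBounded fun κ => (advice κ).size

def NonuniformPPT.outputWithAdvice (D : NonuniformPPT) (κ : ℕ)
    (r : Fin (2 ^ D.coins.eval κ)) (v : Val) : Val :=
  D.toPPT.output κ r (.pair (D.advice κ) v)

/-- The probability that `D` answers `1` on a sample from `X`. -/
def NonuniformPPT.acceptProb (D : NonuniformPPT) (κ : ℕ) (X : PMF Val) : ℝ :=
  ((X.bind fun v => D.toPPT.dist κ (.pair (D.advice κ) v)) (.num 1)).toReal

/-- Computational indistinguishability of two ensembles. -/
def CompIndist (X Y : ℕ → PMF Val) : Prop :=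
  ∀ D : NonuniformPPT, Negligible fun κ => |D.acceptProb κ (X κ) - D.acceptProb κ (Y κ)|

/-! The algorithms of the scheme -/

/-- Public parameters: an RSA modulus `N`, the range `{0, …, q - 1}` of the pads, and a
description `seed` of a hash function. -/
structure Params where
  N : ℕ
  q : ℕ
  seed : Val
  rsa : ∃ a b : ℕ, a.Prime ∧ b.Prime ∧ a ≠ b ∧ N = a * b
  q_pos : 0 < q

instance (P : Params) : NeZero P.q := ⟨P.q_pos.ne'⟩

def Params.encode (P : Params) : Val := .pair (.num P.N) (.pair (.num P.q) P.seed)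

/-- The multiplicative group of integers modulo `N ^ 2`. -/
abbrev Params.Grp (P : Params) : Type := (ZMod (P.N ^ 2))ˣ

/-- The unit `1 + N` modulo `N ^ 2`. -/
def Params.onePlusN (P : Params) : P.Grp where
  val := 1 + (P.N : ZMod (P.N ^ 2))
  inv := 1 - (P.N : ZMod (P.N ^ 2))
  val_inv := by
    have h : ((P.N : ZMod (P.N ^ 2))) ^ 2 = 0 := by
      exact_mod_cast ZMod.natCast_self (P.N ^ 2)
    linear_combination -h
  inv_val := by
    have h : ((P.N : ZMod (P.N ^ 2))) ^ 2 = 0 := by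
      exact_mod_cast ZMod.natCast_self (P.N ^ 2)
    linear_combination -h

/-- The data of an instance of the scheme: the number of users, the setup algorithm of the
crypto server, the times at which aggregations may take place, and the hash function `H`.
Key generation, masking and aggregation are defined below. -/
structure Scheme where
  users : ℕ → ℕ
  users_bounded : PolyBounded users
  setupCoins : Polynomial ℕ
  setup : (κ : ℕ) → Fin (2 ^ setupCoins.eval κ) → Params
  setup_polyTime : ∃ f, PolyTime f ∧
    ∀ (κ : ℕ) (ρ : Fin (2 ^ setupCoins.eval κ)),
      f (.pair (secParam κ) (.num ρ)) = (setup κ ρ).encode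
  times : ℕ → Set ℕ
  times_bounded : ∃ τ, PolyBounded τ ∧ ∀ κ, ∀ t ∈ times κ, t < 2 ^ τ κ
  hash : (P : Params) → ℕ → P.Grp
  hash_polyTime : ∃ f, PolyTime f ∧
    ∀ P t, f (.pair P.encode (.num t)) = .num (hash P t : ZMod (P.N ^ 2)).val

/-- The random choices of key generation: `s ν μ` is chosen by user `ν` for user `μ`. -/
abbrev Pads (n : ℕ) (P : Params) : Type := Fin n → Fin n → Fin P.q

/-- The number that user `ν` sends to user `μ` over a secure channel (`0` if `ν = μ`). -/
def share {n : ℕ} {P : Params} (s : Pads n P) (ν μ : Fin n) : ℕ :=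
  if ν = μ then 0 else (s ν μ : ℕ)

/-- The secret key `p_ν = ∑_μ (s_{ν,μ} - s_{μ,ν})` of user `ν`. -/
def key {n : ℕ} {P : Params} (s : Pads n P) (ν : Fin n) : ℤ :=
  ∑ μ, ((share s ν μ : ℤ) - (share s μ ν : ℤ))

/-- A summation function of `n κ` arguments: the sum of one integer of at most `bits κ` bits
from each user. -/
structure SummationFunction (n : ℕ → ℕ) where
  bits : ℕ → ℕ
  bits_bounded : PolyBounded bits

def SummationFunction.domain {n : ℕ → ℕ} (f : SummationFunction n) (κ : ℕ) :
    Set (Fin (n κ) → ℤ) :=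
  {x | ∀ ν, |x ν| < 2 ^ f.bits κ}

def SummationFunction.eval {n : ℕ → ℕ} (_f : SummationFunction n) (κ : ℕ)
    (x : Fin (n κ) → ℤ) : ℤ :=
  ∑ ν, x ν

namespace Scheme

variable (Φ : Scheme)

/-- The masked value `(1 + N)^x * H(t)^p` modulo `N ^ 2`. -/
def mask (P : Params) (t : ℕ) (x p : ℤ) : P.Grp := P.onePlusN ^ x * Φ.hash P t ^ p

/-- The value computed by the aggregator from the masked values: `((∏ y_ν - 1) mod N ^ 2) / N`
modulo `N`. -/
def aggregate {n : ℕ} (P : Params) (y : Fin n → P.Grp) : ℕ :=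
  ((((∏ ν, y ν : P.Grp) : ZMod (P.N ^ 2)) - 1).val / P.N) % P.N

theorem coe_onePlusN_zpow (P : Params) (m : ℤ) :
    ((P.onePlusN ^ m : P.Grp) : ZMod (P.N ^ 2)) = 1 + m * P.N := by
  have h : ((P.N : ZMod (P.N ^ 2))) ^ 2 = 0 := by
    exact_mod_cast ZMod.natCast_self (P.N ^ 2)
  have h1 : (P.onePlusN : ZMod (P.N ^ 2)) = 1 + P.N := rfl
  have h2 : ((P.onePlusN⁻¹ : P.Grp) : ZMod (P.N ^ 2)) = 1 - P.N := rfl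
  induction m using Int.induction_on with
  | zero => simp
  | succ i ih =>
    rw [zpow_add_one, Units.val_mul, ih, h1]; push_cast; linear_combination (i : ZMod (P.N ^ 2)) * h
  | pred i ih =>
    rw [zpow_sub_one, Units.val_mul, ih, h2]; push_cast; linear_combination (i : ZMod (P.N ^ 2)) * h

theorem sum_key {n : ℕ} {P : Params} (s : Pads n P) : ∑ ν, key s ν = 0 := by
  simp only [key, Finset.sum_sub_distrib]
  rw [Finset.sum_comm, sub_self]

/-- The aggregator obtains the sum of the inputs modulo `N`. -/
theorem aggregate_mask {n : ℕ} (P : Params) (s : Pads n P) (t : ℕ) (x : Fin n → ℤ) :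
    (aggregate P (fun ν => Φ.mask P t (x ν) (key s ν)) : ℤ) = (∑ ν, x ν) % P.N := by
  have hN : 0 < P.N := by
    obtain ⟨a, b, ha, hb, -, h⟩ := P.rsa
    rw [h]; exact Nat.mul_pos ha.pos hb.pos
  have hp : (∏ ν, Φ.mask P t (x ν) (key s ν)) = P.onePlusN ^ (∑ ν, x ν) := by
    have hs : ∀ (g : P.Grp) (z : Fin n → ℤ), ∏ ν, g ^ z ν = g ^ (∑ ν, z ν) := fun g z =>
      (map_sum (zmultiplesHom (Additive P.Grp) (Additive.ofMul g)) z Finset.univ).symm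
    simp only [mask, Finset.prod_mul_distrib, hs, sum_key, zpow_zero, mul_one]
  obtain ⟨k, hk⟩ := Int.eq_ofNat_of_zero_le (Int.emod_nonneg (∑ ν, x ν) (by omega : (P.N : ℤ) ≠ 0))
  have hkN : k < P.N := by
    have := Int.emod_lt_of_pos (∑ ν, x ν) (by omega : (0 : ℤ) < P.N)
    omega
  have hz : ((∑ ν, x ν : ℤ) : ZMod (P.N ^ 2)) * P.N = ((k * P.N : ℕ) : ZMod (P.N ^ 2)) := by
    have h : ((P.N : ZMod (P.N ^ 2))) ^ 2 = 0 := by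
      exact_mod_cast ZMod.natCast_self (P.N ^ 2)
    have e := Int.emod_add_mul_ediv (∑ ν, x ν) P.N
    rw [hk] at e
    rw [← e]; push_cast
    linear_combination (((∑ ν, x ν) / P.N : ℤ) : ZMod (P.N ^ 2)) * h
  unfold aggregate
  rw [hp, coe_onePlusN_zpow, add_sub_cancel_left, hz, ZMod.val_natCast,
    Nat.mod_eq_of_lt (by nlinarith : k * P.N < P.N ^ 2), Nat.mul_div_cancel _ hN, Nat.mod_eq_of_lt hkN, hk]

/-- All the masked values at time `t`, as they are published. -/
def maskedValues {n : ℕ} (P : Params) (s : Pads n P) (t : ℕ) (x : Fin n → ℤ) : Val :=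
  .ofTuple fun ν => .num (Φ.mask P t (x ν) (key s ν) : ZMod (P.N ^ 2)).val

/-- The sets of parties controlled by the adversary, one for each security parameter:
`some ν` is the user `ν`, and `none` is the aggregator. -/
abbrev Coalition : Type := (κ : ℕ) → Finset (Option (Fin (Φ.users κ)))

/-- The number of corrupted parties is `O(log κ)`. -/
def IsLogSize (C : Φ.Coalition) : Prop :=
  (fun κ => ((C κ).card : ℝ)) =O[atTop] fun κ : ℕ => Real.log κ

/-- Restriction of a tuple to the users in the coalition. -/
def restrict {n : ℕ} (C : Finset (Option (Fin n))) (g : Fin n → Val) : Val :=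
  .ofTuple fun ν => if some ν ∈ C then g ν else .num 0

/-- What the coalition sees until the end of key generation: the public parameters and, for
each of its users, the random numbers chosen and those received from the other users. -/
def keyView {n : ℕ} (P : Params) (s : Pads n P) (C : Finset (Option (Fin n))) : Val :=
  .pair P.encode (restrict C fun ν =>
    .pair (.ofTuple fun μ => .num (share s ν μ)) (.ofTuple fun μ => .num (share s μ ν)))

/-- The description of a coalition. -/
def encodeCoalition {n : ℕ} (C : Finset (Option (Fin n))) : Val :=
  .pair (.num (if none ∈ C then 1 else 0))
    (.ofTuple fun ν : Fin n => .num (if some ν ∈ C then 1 else 0))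

/-- The inputs of the corrupted users. -/
def coalitionInputs {n : ℕ} (C : Finset (Option (Fin n))) (x : Fin n → ℤ) : Val :=
  restrict C fun ν => .ofInt (x ν)

/-! The data publishing game -/

/-- A time domain: a set of times for each `κ`, contained in the times of the scheme, in which
membership can be decided in polynomial time with advice. -/
def IsTimeDomain (T : ℕ → Set ℕ) : Prop :=
  (∀ κ, T κ ⊆ Φ.times κ) ∧
  ∃ (f : Val → Val) (advice : ℕ → Val), PolyTime f ∧ PolyBounded (fun κ => (advice κ).size) ∧
    ∀ κ t, t ∈ T κ ↔ f (.pair (secParam κ) (.pair (advice κ) (.num t))) = .num 1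

/-- An adversary in the data publishing game. It declares a coalition, makes `queries₁` and
`queries₂` oracle queries in the two phases, and computes each of its messages from the answers
that it has received so far. -/
structure MaskAdversary extends NonuniformPPT where
  coalition : Φ.Coalition
  queries₁ : Polynomial ℕ
  queries₂ : Polynomial ℕ

/-- A tuple of integers submitted by an adversary. -/
def readInputs (n : ℕ) (v : Val) : Fin n → ℤ := fun ν => (v.entry ν).toInt

open Classical in
/-- `k` rounds of queries to the masking oracle: `next` computes the next query `(t, x)` from
the list of answers so far. The answer consists of the masked values of all users if `t` lies
in the domain `T` and has not been used before; otherwise it is empty. -/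
def queryPhase {n : ℕ} (T : Set ℕ) (oracle : ℕ → (Fin n → ℤ) → Val) (next : List Val → Val) :
    ℕ → List ℕ → List Val → List Val
  | 0, _, h => h
  | k + 1, used, h =>
    let t := (next h).fst.toNat
    let x := readInputs n (next h).snd
    if t ∈ T ∧ t ∉ used then queryPhase T oracle next k (t :: used) (h ++ [oracle t x])
    else queryPhase T oracle next k used (h ++ [.num 0])

open Classical in
/-- The answer to the challenge `(t, x₀, x₁)`: the masked values of `x_b`, if `t` lies in the
challenge domain, the two tuples have the same sum, and they agree at the users that the
adversary controls itself; otherwise it is empty. -/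
def challengeAnswer {n : ℕ} (T : Set ℕ) (oracle : ℕ → (Fin n → ℤ) → Val)
    (C : Finset (Option (Fin n))) (b : Bool) (msg : Val) : Val :=
  let t := msg.fst.toNat
  let x₀ := readInputs n msg.snd.fst
  let x₁ := readInputs n msg.snd.snd
  if t ∈ T ∧ ∑ ν, x₀ ν = ∑ ν, x₁ ν ∧ ∀ ν, some ν ∈ C → x₀ ν = x₁ ν then
    oracle t (if b then x₁ else x₀)
  else .num 0

variable {Φ}

/-- The guess of the adversary, for given random choices. -/
def MaskAdversary.guess (𝒜 : Φ.MaskAdversary) (T₁ T₂ Tc : ℕ → Set ℕ) (κ : ℕ) (P : Params)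
    (s : Pads (Φ.users κ) P) (r : Fin (2 ^ 𝒜.coins.eval κ)) (b : Bool) : Bool :=
  let next : List Val → Val := fun h => 𝒜.outputWithAdvice κ r (.ofList h)
  let oracle := Φ.maskedValues P s
  let h₀ := [keyView P s (𝒜.coalition κ)]
  let h₁ := queryPhase (T₁ κ) oracle next (𝒜.queries₁.eval κ) [] h₀
  let h₂ := h₁ ++ [challengeAnswer (Tc κ) oracle (𝒜.coalition κ) b (next h₁)]
  let h₃ := queryPhase (T₂ κ) oracle next (𝒜.queries₂.eval κ) [] h₂
  decide ((next h₃).toNat = 1)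

/-- The data publishing game; its outcome is `true` if the guess is right. -/
def MaskAdversary.game (𝒜 : Φ.MaskAdversary) (T₁ T₂ Tc : ℕ → Set ℕ) (κ : ℕ) : PMF Bool :=
  (PMF.uniformOfFintype (Fin (2 ^ Φ.setupCoins.eval κ))).bind fun ρ =>
  (PMF.uniformOfFintype (Pads (Φ.users κ) (Φ.setup κ ρ))).bind fun s =>
  (PMF.uniformOfFintype (Fin (2 ^ 𝒜.coins.eval κ))).bind fun r =>
  (PMF.uniformOfFintype Bool).map fun b =>
    𝒜.guess T₁ T₂ Tc κ (Φ.setup κ ρ) s r b == b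

def MaskAdversary.advantage (𝒜 : Φ.MaskAdversary) (T₁ T₂ Tc : ℕ → Set ℕ) (κ : ℕ) : ℝ :=
  |(𝒜.game T₁ T₂ Tc κ true).toReal - 1 / 2|

variable (Φ)

/-- The random masking is indistinguishable under chosen-plaintext attacks. -/
def IsINDCPA : Prop :=
  ∀ T₁ T₂ Tc : ℕ → Set ℕ, Φ.IsTimeDomain T₁ → Φ.IsTimeDomain T₂ → Φ.IsTimeDomain Tc →
    (∀ κ, Disjoint (T₁ κ) (T₂ κ)) → (∀ κ, Disjoint (T₁ κ) (Tc κ)) →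
    (∀ κ, Disjoint (T₂ κ) (Tc κ)) →
    ∀ 𝒜 : Φ.MaskAdversary, Φ.IsLogSize 𝒜.coalition → Negligible (𝒜.advantage T₁ T₂ Tc)

/-! Simulation-based privacy -/

/-- The view of the coalition in an execution of the protocol at time `t` on the inputs `x`:
time, coalition, its inputs, the public parameters, its random numbers and the numbers received
in key generation, and the masked values of all users, which are published. -/
def view (C : Φ.Coalition) (t : ℕ → ℕ) (x : (κ : ℕ) → Fin (Φ.users κ) → ℤ) (κ : ℕ) : PMF Val :=
  (PMF.uniformOfFintype (Fin (2 ^ Φ.setupCoins.eval κ))).bind fun ρ =>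
  (PMF.uniformOfFintype (Pads (Φ.users κ) (Φ.setup κ ρ))).map fun s =>
    .ofList [.num (t κ), encodeCoalition (C κ), coalitionInputs (C κ) (x κ),
      keyView (Φ.setup κ ρ) s (C κ), Φ.maskedValues (Φ.setup κ ρ) s (t κ) (x κ)]

/-- The output of a simulator that is given the time, the output `z` of the function, the
coalition, and the inputs of the corrupted users. -/
def simulation (S : PPT) (C : Φ.Coalition) (t : ℕ → ℕ) (z : ℕ → ℤ)
    (x : (κ : ℕ) → Fin (Φ.users κ) → ℤ) (κ : ℕ) : PMF Val :=
  S.dist κ (.ofList [.num (t κ), .ofInt (z κ), encodeCoalition (C κ),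
    coalitionInputs (C κ) (x κ)])

/-- The scheme is private for the class `F` against semi-honest adversaries that control the
coalition `C`. -/
def IsPrivateFor (F : Set (SummationFunction Φ.users)) (C : Φ.Coalition) : Prop :=
  ∀ f ∈ F, ∃ S : PPT, ∀ t : ℕ → ℕ, (∀ κ, t κ ∈ Φ.times κ) →
    ∀ x : (κ : ℕ) → Fin (Φ.users κ) → ℤ, (∀ κ, x κ ∈ f.domain κ) →
      CompIndist (Φ.simulation S C t (fun κ => f.eval κ (x κ)) x) (Φ.view C t x)

end Scheme

end Feddy

end

noncomputable section

namespace Feddy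

/-! The simulator runs setup and key generation itself and then executes the protocol on stand-in
inputs: corrupted users keep their inputs, the first honest user gets the sum of all honest inputs,
and the other honest users get `0`. The honest sum is known, being `f(X)` minus the corrupted
inputs. If everybody is corrupted, the stand-in inputs are the true ones.

Two gaps separate the simulation from the real view. The first is computational
(`compIndist_viewWith`). True and stand-in inputs have equal sums and agree on the coalition, so
they form an admissible challenge. An adversary with a distinguisher, the time and both tuples in
its advice makes no queries, submits this challenge, assembles the view from the answer and repeats
the verdict of the distinguisher. Its advantage is half the distinguishing gap, hence negligible by
IND-CPA.

The second is statistical (`abs_acceptProb_simulation_sub_le`). Fair coins do not give exactly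
uniform pads below `q`, so the simulator reduces uniform digits in base `B` modulo `q`. Each residue
has at least `⌊B / q⌋` preimages, and Bernoulli's inequality bounds the error for `n ^ 2` pads by `n
^ 2 * q / B`. With `κ` more bits in `B` than `q` can have, this is at most a polynomial divided by
`2 ^ κ`.

The remaining work is to show that the simulator is a polynomial-time program (`exists_simulator`).
Loops are reduced to folds over lists (`PolyTime.foldl`). Numbers are binary, so a counter of length
`log m` is obtained by halving `m`, and small numbers such as `κ` and the indices of users are
carried as powers of two. This yields modular powers by repeated squaring and inverses by the
Euclidean algorithm, the latter for negative keys. -/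

/-! ### Lengths of data. -/

theorem monotone_polynomial_eval (P : Polynomial ℕ) : Monotone fun n => P.eval n := by
  intro a b h
  induction P using Polynomial.induction_on' with
  | add p q hp hq => simpa using add_le_add hp hq
  | monomial n c => simpa using Nat.mul_le_mul_left c (Nat.pow_le_pow_left h n)

theorem natSize_add_le (a b : ℕ) : Nat.size (a + b) ≤ Nat.size a + Nat.size b := by
  rcases Nat.eq_zero_or_pos a with rfl | ha
  · simp
  rcases Nat.eq_zero_or_pos b with rfl | hb
  · simp
  rw [Nat.size_le, pow_add]
  have h1 := Nat.lt_size_self a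
  have h2 := Nat.lt_size_self b
  nlinarith

theorem natSize_mul_le (a b : ℕ) : Nat.size (a * b) ≤ Nat.size a + Nat.size b := by
  rw [Nat.size_le, pow_add]
  exact Nat.mul_lt_mul'' (Nat.lt_size_self a) (Nat.lt_size_self b)

namespace Val

theorem one_le_size (v : Val) : 1 ≤ v.size := by cases v <;> simp [size]

theorem size_num (n : ℕ) : (num n).size = Nat.size n + 1 := rfl

theorem size_pair (a b : Val) : (pair a b).size = a.size + b.size + 1 := rfl

theorem size_num_mono {m n : ℕ} (h : m ≤ n) : (num m).size ≤ (num n).size := by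
  simpa [size] using Nat.size_le_size h

theorem size_num_add_le (a b : ℕ) : (num (a + b)).size ≤ (num a).size + (num b).size := by
  have := natSize_add_le a b
  simp only [size]; omega

theorem size_num_mul_le (a b : ℕ) : (num (a * b)).size ≤ (num a).size + (num b).size := by
  have := natSize_mul_le a b
  simp only [size]; omega

theorem size_fst_add_snd_le (v : Val) : v.fst.size + v.snd.size ≤ v.size + 1 := by
  cases v <;> simp [size, fst, snd]; omega

theorem size_fst_le (v : Val) : v.fst.size ≤ v.size := by
  have := size_fst_add_snd_le v; have := one_le_size v.snd; omega

theorem size_snd_le (v : Val) : v.snd.size ≤ v.size := by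
  have := size_fst_add_snd_le v; have := one_le_size v.fst; omega

theorem size_toNat_le (v : Val) : (num v.toNat).size ≤ v.size := by
  cases v <;> simp [size, toNat]

/-- The entries of an encoded list. -/
def toList : Val → List Val
  | pair a l => a :: toList l
  | num _ => []

@[simp] theorem toNat_num (n : ℕ) : (num n).toNat = n := rfl

@[simp] theorem fst_pair (a b : Val) : (pair a b).fst = a := rfl

@[simp] theorem snd_pair (a b : Val) : (pair a b).snd = b := rfl

@[simp] theorem toList_num (n : ℕ) : (num n).toList = [] := rfl

@[simp] theorem toList_pair (a l : Val) : (pair a l).toList = a :: l.toList := rfl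

@[simp] theorem toList_ofList (l : List Val) : (ofList l).toList = l := by
  induction l with
  | nil => rfl
  | cons a l ih => simp [ofList, ih]

theorem toList_ofTuple {n : ℕ} (g : Fin n → Val) : (ofTuple g).toList = List.ofFn g :=
  toList_ofList _

theorem length_toList_le (v : Val) : v.toList.length ≤ v.size := by
  induction v with
  | num n => simp
  | pair a l _ ih => simp [size]; omega

end Val

open Val

theorem Op.size_apply_le (o : Op) (v : Val) : (o.apply v).size ≤ (v.size + 1) ^ 2 := by
  have key : (o.apply v).size ≤ v.size + 1 := by
    have h1 := v.one_le_size
    have h0 : (num 0).size = 1 := rfl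
    have h2 : (num 1).size = 2 := rfl
    cases o
    · simp [Op.apply]
    · exact (size_fst_le v).trans (Nat.le_succ _)
    · exact (size_snd_le v).trans (Nat.le_succ _)
    all_goals
      unfold Op.apply
      split
      all_goals try contradiction
      all_goals try omega
      all_goals simp only [size_pair]
    · exact (size_num_add_le _ _).trans (by omega)
    · exact (size_num_mono (Nat.sub_le _ _)).trans (by omega)
    · exact (size_num_mul_le _ _).trans (by omega)
    · exact (size_num_mono (Nat.div_le_self _ _)).trans (by omega)
    · exact (size_num_mono (Nat.mod_le _ _)).trans (by omega)
    · split <;> omega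
  nlinarith

/-- Every copy is charged its length and every instruction at least the length of its result. This
is what makes polynomial time closed under composition. -/
theorem Runs.size_le {p : Prog} {v w : Val} {t : ℕ} (h : Runs p v w t) : w.size ≤ t := by
  induction h with
  | op o v => exact Op.size_apply_le o v
  | const c v => omega
  | pair _ _ h1 h2 => simp only [size]; omega
  | comp _ _ _ h2 => omega
  | ite_true _ _ _ _ h => omega
  | ite_false _ _ _ h => omega
  | loop_done _ _ => omega
  | loop_step _ _ _ _ _ _ h => omega

/-! ### Closure properties of polynomial time; loops and folds. -/

namespace PolyTime

theorem size_le {f : Val → Val} (hf : PolyTime f) :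
    ∃ P : Polynomial ℕ, ∀ v, (f v).size ≤ P.eval v.size := by
  obtain ⟨p, P, h⟩ := hf
  refine ⟨P, fun v => ?_⟩
  obtain ⟨t, ht, hr⟩ := h v
  exact hr.size_le.trans ht

theorem op (o : Op) : PolyTime o.apply :=
  ⟨.op o, (Polynomial.X + 1) ^ 2, fun v => ⟨_, by simp, .op o v⟩⟩

theorem id : PolyTime fun v => v := op .id

theorem const (c : Val) : PolyTime fun _ => c :=
  ⟨.const c, Polynomial.C (c.size + 1), fun v => ⟨_, by simp, .const c v⟩⟩

theorem comp {f g : Val → Val} (hg : PolyTime g) (hf : PolyTime f) :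
    PolyTime fun v => g (f v) := by
  obtain ⟨p, P, hp⟩ := hf
  obtain ⟨q, Q, hq⟩ := hg
  refine ⟨.comp p q, P + Q.comp P + 1, fun v => ?_⟩
  obtain ⟨s, hs, h1⟩ := hp v
  obtain ⟨t, ht, h2⟩ := hq (f v)
  refine ⟨_, ?_, .comp h1 h2⟩
  -- The second program runs on an intermediate result no longer than the running time of the first.
  have := monotone_polynomial_eval Q (h1.size_le.trans hs)
  simp only [Polynomial.eval_add, Polynomial.eval_comp, Polynomial.eval_one]
  simp only at this
  omega

theorem pair {f g : Val → Val} (hf : PolyTime f) (hg : PolyTime g) :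
    PolyTime fun v => .pair (f v) (g v) := by
  obtain ⟨p, P, hp⟩ := hf
  obtain ⟨q, Q, hq⟩ := hg
  refine ⟨.pair p q, P + Q + Polynomial.X + 1, fun v => ?_⟩
  obtain ⟨s, hs, h1⟩ := hp v
  obtain ⟨t, ht, h2⟩ := hq v
  refine ⟨_, ?_, .pair h1 h2⟩
  simp; omega

theorem fst {f : Val → Val} (hf : PolyTime f) : PolyTime fun v => (f v).fst := (op .fst).comp hf

theorem snd {f : Val → Val} (hf : PolyTime f) : PolyTime fun v => (f v).snd := (op .snd).comp hf

theorem entry {f : Val → Val} (i : ℕ) (hf : PolyTime f) : PolyTime fun v => (f v).entry i := by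
  induction i generalizing f with
  | zero => exact hf.fst
  | succ i ih => exact ih hf.snd

section Arithmetic

variable {f g : Val → ℕ}

theorem add (hf : PolyTime fun v => num (f v)) (hg : PolyTime fun v => num (g v)) :
    PolyTime fun v => num (f v + g v) := (op .add).comp (hf.pair hg)

theorem sub (hf : PolyTime fun v => num (f v)) (hg : PolyTime fun v => num (g v)) :
    PolyTime fun v => num (f v - g v) := (op .sub).comp (hf.pair hg)

theorem mul (hf : PolyTime fun v => num (f v)) (hg : PolyTime fun v => num (g v)) :
    PolyTime fun v => num (f v * g v) := (op .mul).comp (hf.pair hg)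

theorem div (hf : PolyTime fun v => num (f v)) (hg : PolyTime fun v => num (g v)) :
    PolyTime fun v => num (f v / g v) := (op .div).comp (hf.pair hg)

theorem mod (hf : PolyTime fun v => num (f v)) (hg : PolyTime fun v => num (g v)) :
    PolyTime fun v => num (f v % g v) := (op .mod).comp (hf.pair hg)

theorem toNat {f : Val → Val} (hf : PolyTime f) : PolyTime fun v => num (f v).toNat := by
  convert (op .add).comp (hf.pair (const (num 0))) with v
  cases f v <;> rfl

theorem ite_zero {F G : Val → Val} (hf : PolyTime fun v => num (f v)) (hF : PolyTime F)
    (hG : PolyTime G) : PolyTime fun v => if f v = 0 then F v else G v := by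
  obtain ⟨c, Pc, hc⟩ := hf
  obtain ⟨p, P, hp⟩ := hF
  obtain ⟨q, Q, hq⟩ := hG
  refine ⟨.ite c q p, Pc + P + Q + Polynomial.X + 1, fun v => ?_⟩
  obtain ⟨r, hr, h0⟩ := hc v
  obtain ⟨s, hs, h1⟩ := hp v
  obtain ⟨t, ht, h2⟩ := hq v
  by_cases h : f v = 0
  · beta_reduce at h0 ⊢
    rw [h] at h0
    rw [if_pos h]
    refine ⟨_, ?_, .ite_false h0 h1⟩
    simp; omega
  · beta_reduce at h0 ⊢
    rw [if_neg h]
    refine ⟨_, ?_, .ite_true h0 (by simpa using h) h2⟩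
    simp; omega

theorem ite_eq {F G : Val → Val} (hf : PolyTime fun v => num (f v))
    (hg : PolyTime fun v => num (g v)) (hF : PolyTime F) (hG : PolyTime G) :
    PolyTime fun v => if f v = g v then F v else G v := by
  -- Subtraction is truncated: both differences vanish exactly when the numbers are equal.
  convert ite_zero ((hf.sub hg).add (hg.sub hf)) hF hG using 2 with v
  exact if_congr (by omega) rfl rfl

theorem ite_lt {F G : Val → Val} (hf : PolyTime fun v => num (f v))
    (hg : PolyTime fun v => num (g v)) (hF : PolyTime F) (hG : PolyTime G) :
    PolyTime fun v => if f v < g v then F v else G v := by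
  -- For truncated subtraction, `f + 1 - g = 0` means `f < g`.
  convert ite_zero (((hf.add (const (num 1))).sub hg)) hF hG using 2 with v
  exact if_congr (by omega) rfl rfl

theorem congr {f g : Val → Val} (hf : PolyTime f) (h : ∀ v, g v = f v) : PolyTime g :=
  (funext h : g = f) ▸ hf

end Arithmetic

/-- A common bound `M` for all intermediate states bounds the cost of each test and each round;
there are `k + 1` tests and `k` rounds. -/
theorem runs_loop {c f : Val → Val} {p q : Prog} {P Q : Polynomial ℕ}
    (hp : ∀ v, ∃ t ≤ P.eval v.size, Runs p v (c v) t)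
    (hq : ∀ v, ∃ t ≤ Q.eval v.size, Runs q v (f v) t) {M k : ℕ} {v : Val}
    (hM : ∀ i ≤ k, (f^[i] v).size ≤ M) (h1 : ∀ i < k, c (f^[i] v) ≠ num 0)
    (h0 : c (f^[k] v) = num 0) :
    ∃ t ≤ (k + 1) * (P.eval M + Q.eval M + M + 1), Runs (.loop p q) v (f^[k] v) t := by
  have key : ∀ w : Val, w.size ≤ M → P.eval w.size ≤ P.eval M ∧ Q.eval w.size ≤ Q.eval M :=
    fun w hw => ⟨monotone_polynomial_eval P hw, monotone_polynomial_eval Q hw⟩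
  induction k generalizing v with
  | zero =>
    obtain ⟨r, hr, h⟩ := hp v
    have h0' : c v = num 0 := h0
    rw [h0'] at h
    have hv := hM 0 le_rfl
    have hk := key v hv
    simp only [Function.iterate_zero, id_eq] at hv ⊢
    exact ⟨_, by omega, .loop_done h⟩
  | succ k ih =>
    obtain ⟨t, ht, hrun⟩ := ih (v := f v) (fun i hi => hM (i + 1) (by omega))
      (fun i hi => h1 (i + 1) (by omega)) h0
    obtain ⟨r, hr, hcr⟩ := hp v
    obtain ⟨s, hs, hfs⟩ := hq v
    have hv := hM 0 (by omega)
    have hk := key v hv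
    simp only [Function.iterate_zero, id_eq] at hv
    exact ⟨_, by rw [add_mul (k + 1)]; omega, .loop_step hcr (h1 0 (by omega)) hfs hrun⟩

/-- A while loop takes polynomial time if the number of rounds and the lengths of all the
intermediate states are polynomially bounded. -/
theorem loop {c f : Val → Val} (hc : PolyTime c) (hf : PolyTime f) (k : Val → ℕ)
    (K M : Polynomial ℕ) (hk : ∀ v, k v ≤ K.eval v.size)
    (hM : ∀ v, ∀ i ≤ k v, (f^[i] v).size ≤ M.eval v.size)
    (h1 : ∀ v, ∀ i < k v, c (f^[i] v) ≠ num 0) (h0 : ∀ v, c (f^[k v] v) = num 0) :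
    PolyTime fun v => f^[k v] v := by
  obtain ⟨p, P, hp⟩ := hc
  obtain ⟨q, Q, hq⟩ := hf
  refine ⟨.loop p q, (K + 1) * (P.comp M + Q.comp M + M + 1), fun v => ?_⟩
  obtain ⟨t, ht, h⟩ := runs_loop hp hq (hM v) (h1 v) (h0 v)
  refine ⟨t, ht.trans ?_, h⟩
  simp only [Polynomial.eval_add, Polynomial.eval_mul, Polynomial.eval_comp, Polynomial.eval_one]
  exact Nat.mul_le_mul_right _ (by have := hk v; omega)

/-- Folding over a list takes polynomial time if every round increases the length of the
accumulator by at most a polynomial in the lengths of the context and of the entry. -/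
theorem foldl {F : Val → Val → Val → Val} {c s l : Val → Val}
    (hF : PolyTime fun w => F w.fst w.snd.fst w.snd.snd)
    (hsize : ∃ Q : Polynomial ℕ, ∀ c s a, (F c s a).size ≤ s.size + Q.eval (c.size + a.size))
    (hc : PolyTime c) (hs : PolyTime s) (hl : PolyTime l) :
    PolyTime fun v => (l v).toList.foldl (F (c v)) (s v) := by
  obtain ⟨Q, hQ⟩ := hsize
  -- The loop state is the triple of context, accumulator and unread rest of the list.
  let step : Val → Val := fun w => .pair w.fst (.pair (F w.fst w.snd.fst w.snd.snd.fst) w.snd.snd.snd)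
  have hstep : PolyTime step :=
    id.fst.pair ((hF.comp (id.fst.pair (id.snd.fst.pair id.snd.snd.fst))).pair id.snd.snd.snd)
  have hcond : PolyTime fun w : Val => Op.isPair.apply w.snd.snd := (op .isPair).comp id.snd.snd
  -- Invariant after `i` rounds: the rest has lost `i` entries, the accumulator has grown
  -- additively, and folding what remains still gives the final result.
  have hit : ∀ (i : ℕ) (c s l : Val), i ≤ l.toList.length →
      ∃ s' l' : Val, step^[i] (.pair c (.pair s l)) = .pair c (.pair s' l') ∧
        l'.toList.length + i = l.toList.length ∧ l'.size ≤ l.size ∧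
        s'.size ≤ s.size + i * Q.eval (c.size + l.size) ∧
        l'.toList.foldl (F c) s' = l.toList.foldl (F c) s := by
    intro i c s l hi
    induction i with
    | zero => exact ⟨s, l, rfl, rfl, le_rfl, by simp, rfl⟩
    | succ i ih =>
      obtain ⟨s', l', h1, h2, h3, h4, h5⟩ := ih (by omega)
      cases l' with
      | num n => simp at h2; omega
      | pair a l' =>
        refine ⟨F c s' a, l', ?_, ?_, ?_, ?_, ?_⟩
        · rw [Function.iterate_succ_apply', h1]; rfl
        · simp at h2; omega
        · simp [size] at h3; omega
        · have := hQ c s' a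
          have h6 := monotone_polynomial_eval Q (by simp [size] at h3; omega :
            c.size + a.size ≤ c.size + l.size)
          simp only at h6
          rw [add_mul]; omega
        · simpa using h5
  let k : Val → ℕ := fun w => w.snd.snd.toList.length
  -- The time bound is needed for every input, also for data that are not such triples. On those the
  -- rest reads as empty, and the loop stops at once.
  have norm : ∀ w : Val, w.snd.snd.toList.length ≠ 0 → w = .pair w.fst (.pair w.snd.fst w.snd.snd) := by
    intro w hw
    rcases w with _ | ⟨a, _ | ⟨b, d⟩⟩
    · simp [Val.snd] at hw
    · simp [Val.snd] at hw
    · rfl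
  have hloop : PolyTime fun w => step^[k w] w := by
    refine loop hcond hstep k Polynomial.X
      (2 * Polynomial.X + Polynomial.X * Q.comp (2 * Polynomial.X) + 2) ?_ ?_ ?_ ?_
    · intro w
      simpa [k] using (length_toList_le _).trans ((size_snd_le _).trans (size_snd_le _))
    · intro w i hi
      by_cases hw : k w = 0
      · obtain rfl : i = 0 := by omega
        simp; omega
      · have hn := norm w hw
        obtain ⟨s', l', h1, h2, h3, h4, -⟩ := hit i w.fst w.snd.fst w.snd.snd hi
        rw [← hn] at h1
        rw [h1]
        have hsz : w.size = w.fst.size + (w.snd.fst.size + w.snd.snd.size + 1) + 1 := by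
          conv_lhs => rw [hn]
          simp [size]
        have h6 := monotone_polynomial_eval Q (by omega : w.fst.size + w.snd.snd.size ≤ 2 * w.size)
        simp only at h6
        have h7 : i ≤ w.size := hi.trans ((length_toList_le _).trans
          ((size_snd_le _).trans (size_snd_le _)))
        have h8 := Nat.mul_le_mul h7 h6
        simp [size]; omega
    · intro w i hi
      have hn := norm w (by intro h; simp only [k] at hi; omega)
      obtain ⟨s', l', h1, h2, -⟩ := hit i w.fst w.snd.fst w.snd.snd hi.le
      rw [← hn] at h1
      rw [h1]
      cases l' with
      | num n => simp [k] at h2 hi; omega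
      | pair a l => simp [Val.snd, Op.apply]
    · intro w
      by_cases hw : k w = 0
      · rw [hw]
        have hw' : w.snd.snd.toList.length = 0 := hw
        simp only [Function.iterate_zero, id_eq]
        rcases h : w.snd.snd with n | ⟨a, l⟩
        · rfl
        · rw [h] at hw'; simp at hw'
      · have hn := norm w hw
        obtain ⟨s', l', h1, h2, -⟩ := hit (k w) w.fst w.snd.fst w.snd.snd le_rfl
        rw [← hn] at h1
        rw [h1]
        cases l' with
        | num n => rfl
        | pair a l => simp [k] at h2
  refine (hloop.comp (hc.pair (hs.pair hl))).snd.fst.congr fun v => ?_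
  obtain ⟨s', l', h1, h2, -, -, h5⟩ := hit (l v).toList.length (c v) (s v) (l v) le_rfl
  change _ = (step^[(l v).toList.length] _).snd.fst
  rw [h1, ← h5]
  cases l' with
  | num n => rfl
  | pair a l => simp at h2

end PolyTime

/-! ### Logarithmic counters and the Euclidean algorithm. -/

/-- The numbers `…, m / 4, m / 2, m`, without zeros. -/
def halvings (m : ℕ) : List ℕ :=
  if m = 0 then [] else halvings (m / 2) ++ [m]
  decreasing_by exact Nat.div_lt_self (by omega) one_lt_two

@[simp] theorem halvings_zero : halvings 0 = [] := by rw [halvings, if_pos rfl]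

theorem halvings_of_ne_zero {m : ℕ} (h : m ≠ 0) : halvings m = halvings (m / 2) ++ [m] := by
  rw [halvings, if_neg h]

/-- This is the number of binary digits of `m`. Writing it with `2 * m` covers `m = 0`, where the
logarithm is `0`. -/
theorem length_halvings (m : ℕ) : (halvings m).length = Nat.log 2 (2 * m) := by
  induction m using Nat.strong_induction_on with
  | _ m ih =>
    by_cases h : m = 0
    · simp [h]
    · rw [halvings_of_ne_zero h, List.length_append, ih _ (Nat.div_lt_self (by omega) one_lt_two),
        List.length_singleton, mul_comm 2 m, Nat.log_mul_base one_lt_two h]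
      by_cases h1 : m = 1
      · simp [h1]
      · have h2 : m / 2 ≠ 0 := by omega
        rw [mul_comm, Nat.log_mul_base one_lt_two h2, Nat.log_div_base]
        have := Nat.log_pos one_lt_two (by omega : 2 ≤ m)
        omega

theorem length_halvings_half (m : ℕ) : (halvings (m / 2)).length = Nat.log 2 m := by
  rw [length_halvings]
  rcases Nat.lt_or_ge m 2 with h | h
  · rw [Nat.div_eq_of_lt h, Nat.log_of_lt h]; simp
  · have h2 : m / 2 ≠ 0 := by omega
    rw [mul_comm, Nat.log_mul_base one_lt_two h2, Nat.log_div_base]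
    have := Nat.log_pos one_lt_two h
    omega

theorem lt_two_pow_length_halvings (m : ℕ) : m < 2 ^ (halvings m).length := by
  rw [length_halvings]
  have := Nat.lt_pow_succ_log_self one_lt_two (2 * m)
  rw [pow_succ] at this
  omega

theorem length_halvings_le_size (m : ℕ) : (halvings m).length ≤ (num m).size := by
  rw [length_halvings]
  by_cases h : m = 0
  · simp [h]
  rw [mul_comm, Nat.log_mul_base one_lt_two h, size_num]
  have := Nat.log_lt_of_lt_pow h (Nat.lt_size_self m)
  omega

/-- This turns a length `n` into the list of the codes `2 ^ i` of all indices `i < n`. -/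
theorem halvings_two_pow_half (n : ℕ) :
    halvings (2 ^ n / 2) = (List.range n).map fun i => 2 ^ i := by
  induction n with
  | zero => simp
  | succ n ih =>
    rw [pow_succ, Nat.mul_div_cancel _ two_pos, halvings_of_ne_zero (by positivity), ih,
      List.range_succ, List.map_append]
    rfl

/-- One round of the computation of `halvings`. -/
def halvingsStep (w : Val) : Val :=
  .pair (num (w.fst.toNat / 2)) (.pair (num w.fst.toNat) w.snd)

/-- One round of the extended Euclidean algorithm modulo `m`. The state consists of two remainders
and of their coefficients. -/
def euclidStep (m : ℕ) (s : Val) : Val :=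
  let r₀ := s.fst.fst.toNat
  let r₁ := s.fst.snd.toNat
  let t₀ := s.snd.fst.toNat
  let t₁ := s.snd.snd.toNat
  if r₁ = 0 then s
  else .pair (.pair (num r₁) (num (r₀ % r₁)))
    -- `m - t₁` stands for `-t₁`. The modulus `m - 1 + 1` is `m` for positive `m`, but it is never
    -- zero, so the coefficient stays bounded for every input.
    (.pair (num t₁) (num ((t₀ + r₀ / r₁ * (m - t₁)) % (m - 1 + 1))))

/-- The inverse of `a` modulo `m`, by the extended Euclidean algorithm. -/
def modInv (a m : ℕ) : ℕ :=
  ((halvings (a * m)).foldl (fun s _ => euclidStep m s)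
    (.pair (.pair (num m) (num a)) (.pair (num 0) (num 1)))).snd.fst.toNat

/-- The congruences `a * tᵢ = rᵢ` and the gcd of the remainders are invariant, and `r₀ * r₁` at
least halves in each round because `2 * (r₀ % r₁) ≤ r₀`. The list `L` is only a clock; once `r₁ =
0`, the state no longer changes, which the second alternative in `hlt` allows. -/
theorem euclid_correct {a m : ℕ} (hm : 1 < m) (L : List ℕ) (r₀ r₁ t₀ t₁ : ℕ)
    (hlt : r₁ < r₀ ∨ r₀ * r₁ = 0) (hL : r₀ * r₁ < 2 ^ L.length)
    (h0 : (a * t₀ : ZMod m) = r₀) (h1 : (a * t₁ : ZMod m) = r₁) (ht : t₁ ≤ m)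
    (hg : Nat.gcd r₀ r₁ = 1) (hr : 0 < r₀):
    ((a * (L.foldl (fun s _ => euclidStep m s) (.pair (.pair (num r₀) (num r₁))
      (.pair (num t₀) (num t₁)))).snd.fst.toNat : ℕ) : ZMod m) = 1 := by
  induction L generalizing r₀ r₁ t₀ t₁ with
  | nil =>
    obtain rfl : r₁ = 0 := by
      simp only [List.length_nil, pow_zero] at hL
      have : r₀ * r₁ = 0 := by omega
      simpa [hr.ne'] using this
    obtain rfl : r₀ = 1 := by simpa using hg
    simpa [Val.snd, Val.fst, Val.toNat] using h0
  | cons x L ih =>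
    rw [List.foldl_cons]
    by_cases hr1 : r₁ = 0
    · subst hr1
      have : euclidStep m (.pair (.pair (num r₀) (num 0)) (.pair (num t₀) (num t₁)))
        = .pair (.pair (num r₀) (num 0)) (.pair (num t₀) (num t₁)) := by
        simp [euclidStep, Val.fst, Val.snd, Val.toNat]
      rw [this]
      exact ih _ _ _ _ (by simp) (by simp) h0 h1 ht hg hr
    · have hstep : euclidStep m (.pair (.pair (num r₀) (num r₁)) (.pair (num t₀) (num t₁)))
        = .pair (.pair (num r₁) (num (r₀ % r₁)))
          (.pair (num t₁) (num ((t₀ + r₀ / r₁ * (m - t₁)) % m))) := by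
        simp [euclidStep, Val.fst, Val.snd, Val.toNat, hr1, Nat.sub_add_cancel hm.le]
      rw [hstep]
      have hmod := Nat.mod_lt r₀ (Nat.pos_of_ne_zero hr1)
      have hdiv := Nat.mod_add_div r₀ r₁
      have hlt' : r₁ < r₀ := by
        rcases hlt with h | h
        · exact h
        · rcases Nat.mul_eq_zero.1 h with h | h <;> omega
      refine ih _ _ _ _ (Or.inl hmod) ?_ h1 ?_ (Nat.mod_lt _ (by omega)).le ?_ (by omega)
      · have h2 : 1 ≤ r₀ / r₁ := Nat.div_pos hlt'.le (by omega)
        have h3 : 2 * (r₀ % r₁) ≤ r₀ := by nlinarith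
        rw [List.length_cons, pow_succ] at hL
        nlinarith
      · rw [ZMod.natCast_mod]
        push_cast [Nat.cast_sub ht]
        have h4 : (r₀ : ZMod m) = (r₀ % r₁ : ℕ) + r₁ * (r₀ / r₁ : ℕ) := by
          exact_mod_cast congrArg (Nat.cast : ℕ → ZMod m) hdiv.symm
        rw [h4, ← h1] at h0
        rw [ZMod.natCast_self]
        linear_combination h0
      · rw [← hg, Nat.gcd_comm r₁, ← Nat.gcd_rec, Nat.gcd_comm]

theorem modInv_spec {a m : ℕ} (hm : 1 < m) (ham : a < m) (h : Nat.Coprime a m) :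
    ((a * modInv a m : ℕ) : ZMod m) = 1 := by
  refine euclid_correct hm _ _ _ _ _ (Or.inl ham) ?_ ?_ ?_ hm.le ?_ (by omega)
  · rw [mul_comm]; exact lt_two_pow_length_halvings _
  · simp
  · simp
  · rw [Nat.gcd_comm]; exact h

/-! ### List operations and modular arithmetic in polynomial time. -/

namespace PolyTime

theorem sum {F : Val → Val → ℕ} {c l : Val → Val} (hF : PolyTime fun w => num (F w.fst w.snd))
    (hc : PolyTime c) (hl : PolyTime l) :
    PolyTime fun v => num ((l v).toList.map (F (c v))).sum := by
  obtain ⟨P, hP⟩ := hF.size_le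
  have hsum : ∀ (c : Val) (L : List Val) (n : ℕ),
      L.foldl (fun s a => num (s.toNat + F c a)) (num n) = num (n + (L.map (F c)).sum) := by
    intro c L
    induction L with
    | nil => intro n; rfl
    | cons a L ih =>
      intro n
      rw [List.foldl_cons, ih, List.map_cons, List.sum_cons, ← add_assoc]
      rfl
  refine (foldl (F := fun c s a => num (s.toNat + F c a)) (s := fun _ => num 0)
    (id.snd.fst.toNat.add (hF.comp (id.fst.pair id.snd.snd)))
    ⟨P.comp (Polynomial.X + 1), fun c s a => ?_⟩ hc (const _) hl).congr fun v => ?_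
  · have h1 := hP (.pair c a)
    have h2 := size_num_add_le s.toNat (F c a)
    have h3 := size_toNat_le s
    simp only [Val.fst, Val.snd, size_pair] at h1
    simp
    omega
  · rw [hsum, zero_add]

theorem reverse {l : Val → Val} (hl : PolyTime l) :
    PolyTime fun v => ofList (l v).toList.reverse := by
  have hrev : ∀ (L : List Val) (M : List Val),
      L.foldl (fun s a => .pair a s) (ofList M) = ofList (L.reverse ++ M) := by
    intro L
    induction L with
    | nil => intro M; rfl
    | cons a L ih =>
      intro M
      rw [List.foldl_cons, List.reverse_cons, List.append_assoc]
      exact ih (a :: M)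
  refine (foldl (F := fun _ s a => .pair a s) (s := fun _ => num 0) (c := fun _ => num 0)
    (id.snd.snd.pair id.snd.fst) ⟨Polynomial.X + 1, fun c s a => ?_⟩
    (const _) (const _) hl).congr fun v => ?_
  · simp [size]; omega
  · have := hrev (l v).toList []
    rw [List.append_nil] at this
    exact this.symm

theorem map {F : Val → Val → Val} {c l : Val → Val} (hF : PolyTime fun w => F w.fst w.snd)
    (hc : PolyTime c) (hl : PolyTime l) :
    PolyTime fun v => ofList ((l v).toList.map (F (c v))) := by
  obtain ⟨P, hP⟩ := hF.size_le
  have hmap : ∀ (c : Val) (L M : List Val),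
      L.foldl (fun s a => .pair (F c a) s) (ofList M) = ofList ((L.map (F c)).reverse ++ M) := by
    intro c L
    induction L with
    | nil => intro M; rfl
    | cons a L ih =>
      intro M
      rw [List.foldl_cons, List.map_cons, List.reverse_cons, List.append_assoc]
      exact ih (F c a :: M)
  refine (foldl (F := fun c s a => .pair (F c a) s) (s := fun _ => num 0)
    ((hF.comp (id.fst.pair id.snd.snd)).pair id.snd.fst)
    -- The fold pushes results onto the front of a list, so it is followed by a reversal.
    ⟨P.comp (Polynomial.X + 1) + 1, fun c s a => ?_⟩ hc (const _) hl).reverse.congr fun v => ?_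
  · have h1 := hP (.pair c a)
    simp only [Val.fst, Val.snd, size_pair] at h1
    simp [size]
    omega
  · have := hmap (c v) (l v).toList []
    rw [List.append_nil] at this
    simp only [ofList] at this
    rw [this, toList_ofList, List.reverse_reverse]

theorem halvings {f : Val → ℕ} (hf : PolyTime fun v => num (f v)) :
    PolyTime fun v => ofList ((Feddy.halvings (f v)).map num) := by
  let k : Val → ℕ := fun w => (Feddy.halvings w.fst.toNat).length
  -- `m` is the current quotient and `M` the list of numbers already recorded. The bound on lengths
  -- holds from any start; the description of the recorded list needs an empty one.
  have hit : ∀ (i : ℕ) (w : Val), i ≤ k w → ∃ (m : ℕ) (M : List ℕ),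
      (halvingsStep^[i] w).fst.toNat = m ∧ m ≤ w.fst.toNat ∧
      (halvingsStep^[i] w).size ≤ 2 * w.size + i * (w.size + 3) ∧
      (Feddy.halvings m).length + i = k w ∧ M.length = i ∧
      Feddy.halvings m ++ M = Feddy.halvings w.fst.toNat ∧
      (w.snd = num 0 → (halvingsStep^[i] w).snd = ofList (M.map num)) := by
    intro i w hi
    induction i with
    | zero => exact ⟨_, [], rfl, le_rfl, by simp; omega, rfl, rfl, by simp, fun h => h⟩
    | succ i ih =>
      obtain ⟨m, M, h1, h2, h3, h4, h5, h6, h7⟩ := ih (by omega)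
      have hm : m ≠ 0 := by
        rintro rfl
        simp at h4; omega
      rw [Feddy.halvings_of_ne_zero hm] at h4 h6
      rw [Function.iterate_succ_apply']
      refine ⟨m / 2, m :: M, ?_, (Nat.div_le_self _ _).trans h2, ?_, ?_, ?_, ?_, ?_⟩
      · rw [← h1]; rfl
      · have h8 := size_num_mono (Nat.div_le_self (halvingsStep^[i] w).fst.toNat 2)
        have h9 := size_num_mono (h1.le.trans h2)
        have h10 := size_toNat_le w.fst
        have h11 := size_fst_le w
        have h12 := size_fst_add_snd_le (halvingsStep^[i] w)
        have h13 : (num ((halvingsStep^[i] w).fst.toNat / 2)).size ≤ (halvingsStep^[i] w).fst.size :=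
          h8.trans (size_toNat_le _)
        rw [add_mul]
        simp only [halvingsStep, size_pair]
        omega
      · simp at h4; omega
      · simp [h5]
      · simpa using h6
      · intro hw
        rw [halvingsStep, snd_pair, h1, h7 hw]; rfl
  have hloop : PolyTime fun w => halvingsStep^[k w] w := by
    refine loop (c := fun w => num w.fst.toNat) (f := halvingsStep) id.fst.toNat
      ((id.fst.toNat.div (const (num 2))).pair (id.fst.toNat.pair id.snd)) k Polynomial.X
      (2 * Polynomial.X + Polynomial.X * (Polynomial.X + 3)) ?_ ?_ ?_ ?_
    · intro w
      simpa using ((length_halvings_le_size _).trans (size_toNat_le _)).trans (size_fst_le w)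
    · intro w i hi
      obtain ⟨m, M, h1, h2, h3, -⟩ := hit i w hi
      have h4 : i ≤ w.size :=
        hi.trans (((length_halvings_le_size _).trans (size_toNat_le _)).trans (size_fst_le w))
      have h5 := Nat.mul_le_mul_right (w.size + 3) h4
      simp
      omega
    · intro w i hi
      obtain ⟨m, M, h1, h2, h3, h4, -⟩ := hit i w hi.le
      rw [h1]
      intro h
      simp only [num.injEq] at h
      subst h
      simp at h4; omega
    · intro w
      obtain ⟨m, M, h1, h2, h3, h4, -⟩ := hit (k w) w le_rfl
      rw [h1, num.injEq]
      have h5 : (Feddy.halvings m).length = 0 := by omega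
      have h6 := lt_two_pow_length_halvings m
      rw [h5] at h6; omega
  refine (hloop.comp (hf.pair (const (num 0)))).snd.congr fun v => ?_
  obtain ⟨m, M, h1, h2, h3, h4, h5, h6, h7⟩ := hit (k (.pair (num (f v)) (num 0))) _ le_rfl
  rw [h7 rfl]
  have h8 : (Feddy.halvings m).length = 0 := by omega
  rw [List.length_eq_zero_iff] at h8
  rw [h8, List.nil_append] at h6
  rw [h6]; rfl

/-- The exponent is given in unary, and each multiplication adds at most the length of the base. -/
theorem pow_length {f : Val → ℕ} {l : Val → Val} (hf : PolyTime fun v => num (f v))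
    (hl : PolyTime l) : PolyTime fun v => num (f v ^ (l v).toList.length) := by
  have hpow : ∀ (b : ℕ) (L : List Val) (n : ℕ),
      L.foldl (fun s _ => num (s.toNat * (num b).toNat)) (num n) = num (n * b ^ L.length) := by
    intro b L
    induction L with
    | nil => intro n; simp
    | cons a L ih =>
      intro n
      rw [List.foldl_cons, ih, List.length_cons, pow_succ']
      simp only [Val.toNat, mul_assoc]
  refine (foldl (F := fun c s _ => num (s.toNat * c.toNat)) (s := fun _ => num 1)
    (id.snd.fst.toNat.mul id.fst.toNat) ⟨Polynomial.X, fun c s a => ?_⟩ hf (const _) hl).congr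
    fun v => ?_
  · have h1 := size_num_mul_le s.toNat c.toNat
    have h2 := size_toNat_le s
    have h3 := size_toNat_le c
    simp; omega
  · rw [hpow, one_mul]

theorem pow_log {f g : Val → ℕ} (hf : PolyTime fun v => num (f v))
    (hg : PolyTime fun v => num (g v)) : PolyTime fun v => num (f v ^ Nat.log 2 (g v)) := by
  refine (hf.pow_length (hg.div (const (num 2))).halvings).congr fun v => ?_
  rw [toList_ofList, List.length_map, length_halvings_half]

/-- With `k = log₂ g`, the power `2 ^ (c * k ^ (n + 1))` is the `k`-th power of `2 ^ (c * k ^ n)`,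
so monomials follow by iterating `pow_log`. For `g = 2 ^ κ` this gives ranges for polynomially many
coins. -/
theorem two_pow_polynomial (P : Polynomial ℕ) {g : Val → ℕ} (hg : PolyTime fun v => num (g v)) :
    PolyTime fun v => num (2 ^ P.eval (Nat.log 2 (g v))) := by
  induction P using Polynomial.induction_on' with
  | add P Q hP hQ =>
    refine (hP.mul hQ).congr fun v => ?_
    rw [Polynomial.eval_add, pow_add]
  | monomial n c =>
    simp only [Polynomial.eval_monomial]
    induction n with
    | zero => simpa using const (num (2 ^ c))
    | succ n ih =>
      refine (ih.pow_log hg).congr fun v => ?_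
      rw [← pow_mul, mul_assoc, ← pow_succ]

theorem range {l : Val → Val} (hl : PolyTime l) :
    PolyTime fun v => ofList ((List.range (l v).toList.length).map fun i => num (2 ^ i)) := by
  refine ((pow_length (const (num 2)) hl).div (const (num 2))).halvings.congr fun v => ?_
  rw [halvings_two_pow_half, List.map_map]; rfl

theorem entry_log {g : Val → ℕ} {l : Val → Val} (hg : PolyTime fun v => num (g v))
    (hl : PolyTime l) : PolyTime fun v => (l v).entry (Nat.log 2 (g v)) := by
  have hentry : ∀ (L : List Val) (w : Val),
      (L.foldl (fun s _ => s.snd) w).fst = w.entry L.length := by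
    intro L
    induction L with
    | nil => intro w; rfl
    | cons a L ih => intro w; rw [List.foldl_cons, ih]; rfl
  refine (foldl (F := fun _ s _ => s.snd) (c := fun _ => num 0) id.snd.fst.snd
    ⟨0, fun c s a => ?_⟩ (const _) hl (hg.div (const (num 2))).halvings).fst.congr fun v => ?_
  · simpa using size_snd_le s
  · rw [hentry, toList_ofList, List.length_map, length_halvings_half]

/-- Repeated squaring: along the halvings of the exponent, the power for `k / 2` is squared and
multiplied by the base if `k` is odd. The modulus `m + 1` is positive, so the accumulator stays
bounded. -/
theorem pow_mod {f g m : Val → ℕ} (hf : PolyTime fun v => num (f v))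
    (hg : PolyTime fun v => num (g v)) (hm : PolyTime fun v => num (m v)) :
    PolyTime fun v => num (f v ^ g v % (m v + 1)) := by
  have hpow : ∀ a m k : ℕ, ((Feddy.halvings k).map num).foldl (fun s d => num
      ((s.toNat * s.toNat * (if d.toNat % 2 = 0 then 1 else a)) % (m + 1))) (num (1 % (m + 1)))
        = num (a ^ k % (m + 1)) := by
    intro a m k
    induction k using Nat.strong_induction_on with
    | _ k ih =>
      by_cases hk : k = 0
      · subst hk; simp
      · rw [halvings_of_ne_zero hk, List.map_append, List.foldl_append,
          ih _ (Nat.div_lt_self (by omega) one_lt_two)]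
        simp only [List.map_cons, List.map_nil, List.foldl_cons, List.foldl_nil, toNat_num,
          num.injEq]
        have h1 := ((Nat.mod_modEq (a ^ (k / 2)) (m + 1)).mul
          (Nat.mod_modEq (a ^ (k / 2)) (m + 1))).mul_right (if k % 2 = 0 then 1 else a)
        refine h1.trans ?_
        rw [← pow_add]
        have h2 := Nat.div_add_mod k 2
        split
        · rw [mul_one]; refine congrArg (fun e => a ^ e % (m + 1)) ?_; omega
        · rw [← pow_succ]; refine congrArg (fun e => a ^ e % (m + 1)) ?_; omega
  refine (foldl (F := fun c s d => num ((s.toNat * s.toNat *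
      (if d.toNat % 2 = 0 then 1 else c.fst.toNat)) % (c.snd.toNat + 1)))
    (s := fun v => num (1 % (m v + 1))) ?_ ⟨Polynomial.X + 2, fun c s d => ?_⟩ (hf.pair hm)
    ((const (num 1)).mod (hm.add (const (num 1)))) hg.halvings).congr fun v => ?_
  · refine ((id.snd.fst.toNat.mul id.snd.fst.toNat).mul ?_).mod (id.fst.snd.toNat.add (const (num 1)))
    refine (ite_zero (F := fun _ => num 1) (id.snd.snd.toNat.mod (const (num 2)))
      (const _) id.fst.fst.toNat).congr fun v => ?_
    split <;> rfl
  · refine (size_num_mono (Nat.mod_lt _ (Nat.succ_pos _)).le).trans ?_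
    have h1 := size_num_add_le c.snd.toNat 1
    have h2 := size_toNat_le c.snd
    have h3 := size_snd_le c
    have h4 : (num 1).size = 2 := rfl
    simp; omega
  · rw [toList_ofList]
    exact (hpow (f v) (m v) (g v)).symm

theorem modInv {f m : Val → ℕ} (hf : PolyTime fun v => num (f v))
    (hm : PolyTime fun v => num (m v)) : PolyTime fun v => num (modInv (f v) (m v)) := by
  refine (foldl (F := fun c s _ => euclidStep c.toNat s) (c := fun v => num (m v))
    (s := fun v => .pair (.pair (num (m v)) (num (f v))) (.pair (num 0) (num 1))) ?_
    ⟨2 * Polynomial.X + 10, fun c s d => ?_⟩ hm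
    ((hm.pair hf).pair ((const (num 0)).pair (const (num 1))))
    (hf.mul hm).halvings).snd.fst.toNat.congr fun v => ?_
  · have r₀ := id.snd.fst.fst.fst.toNat
    have r₁ := id.snd.fst.fst.snd.toNat
    have t₀ := id.snd.fst.snd.fst.toNat
    have t₁ := id.snd.fst.snd.snd.toNat
    have M := id.fst.toNat
    exact ite_zero r₁ id.snd.fst ((r₁.pair (r₀.mod r₁)).pair (t₁.pair
      ((t₀.add ((r₀.div r₁).mul (M.sub t₁))).mod ((M.sub (const (num 1))).add (const (num 1))))))
  · simp only [euclidStep]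
    split
    · simp
    · have h1 := size_num_mono (Nat.mod_le s.fst.fst.toNat s.fst.snd.toNat)
      have h2 := size_toNat_le s.fst.fst
      have h3 := size_toNat_le s.fst.snd
      have h4 := size_toNat_le s.snd.snd
      have h5 := size_fst_add_snd_le s
      have h6 := size_fst_add_snd_le s.fst
      have h7 := size_snd_le s.snd
      -- The new coefficient is bounded by the modulus alone; the new remainders take no more room
      -- than the old ones.
      have h8 := size_num_mono (Nat.mod_lt (s.snd.fst.toNat +
        s.fst.fst.toNat / s.fst.snd.toNat * (c.toNat - s.snd.snd.toNat))
        (Nat.succ_pos (c.toNat - 1))).le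
      have h9 := size_num_add_le (c.toNat - 1) 1
      have h10 := size_num_mono (Nat.sub_le c.toNat 1)
      have h11 := size_toNat_le c
      have h12 : (num 1).size = 2 := rfl
      simp only [size_pair, Polynomial.eval_add, Polynomial.eval_mul, Polynomial.eval_X,
        Polynomial.eval_ofNat]
      simp only [Nat.succ_eq_add_one] at h8
      omega
  · rw [toList_ofList, List.foldl_map]; rfl

end PolyTime

open scoped BigOperators

/-! Averages over coin tosses -/

section Expect

open Finset

/-- Division with remainder splits one tape of coins into two independent uniform parts. -/
theorem expect_fin_mul {a b : ℕ} (g : ℕ → ℕ → ℝ) :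
    𝔼 r : Fin (b * a), g (r % a) (r / a) = 𝔼 i : Fin a, 𝔼 j : Fin b, g i j := by
  rw [expect_comm, ← expect_product', univ_product_univ]
  refine (Fintype.expect_equiv finProdFinEquiv _ _ fun x => ?_).symm
  have ha : 0 < a := x.2.pos
  simp [Nat.add_mul_mod_self_left, Nat.mod_eq_of_lt x.2.2, Nat.add_mul_div_left _ _ ha,
    Nat.div_eq_of_lt x.2.2]

theorem expect_digits {B n : ℕ} (g : (Fin n × Fin n → ℕ) → ℝ) :
    𝔼 r : Fin (B ^ (n * n)), g (fun i => r / ((B ^ n) ^ (i.1 : ℕ) * B ^ (i.2 : ℕ)) % B) =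
      𝔼 d : Fin n × Fin n → Fin B, g fun i => d i := by
  let e : (Fin n × Fin n → Fin B) ≃ Fin (B ^ (n * n)) :=
    (finProdFinEquiv.arrowCongr (Equiv.refl _)).trans finFunctionFinEquiv
  refine (Fintype.expect_equiv e _ _ fun d => congrArg g (funext fun i => ?_)).symm
  obtain ⟨d, rfl⟩ := e.symm.surjective d
  rw [Equiv.apply_symm_apply, ← pow_mul, ← pow_add, add_comm]
  rfl

/-- The numbers `s + q * k` with `k < B / q` are distinct and lie below `B`. -/
theorem div_le_card_mod_eq {q B : ℕ} (s : Fin q) :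
    B / q ≤ (univ.filter fun d : Fin B => (d : ℕ) % q = s).card := by
  have hlt : ∀ k ∈ range (B / q), s + q * k < B := fun k hk => by
    have h1 : q * (k + 1) ≤ q * (B / q) := Nat.mul_le_mul_left _ (mem_range.1 hk)
    have h2 := Nat.mul_div_le B q
    have h3 := s.2
    rw [mul_add, mul_one] at h1
    omega
  rw [← card_range (B / q), ← card_attach]
  refine card_le_card_of_injOn (fun k => ⟨s + q * k.1, hlt k.1 k.2⟩) (fun k _ => ?_) ?_
  · simp [Nat.add_mul_mod_self_left, Nat.mod_eq_of_lt s.2]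
  · intro k _ l _ h
    have hq : 0 < q := s.pos
    simp only [Fin.mk.injEq, add_right_inj] at h
    exact Subtype.ext (Nat.eq_of_mul_eq_mul_left hq h)

/-- Each tuple has at least `⌊B / q⌋ ^ m` preimages, so its probability is at least `(1 - q / B) ^ m
≥ 1 - m * q / B` times the uniform one, by Bernoulli's inequality. -/
theorem expect_mod_ge {ι : Type*} [Fintype ι] [DecidableEq ι] {q B : ℕ} (hq : 0 < q) (hqB : q ≤ B)
    (f : (ι → Fin q) → ℝ) (h0 : ∀ s, 0 ≤ f s) :
    (1 - Fintype.card ι * (q / B : ℝ)) * 𝔼 s, f s ≤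
      𝔼 d : ι → Fin B, f fun i => ⟨d i % q, Nat.mod_lt _ hq⟩ := by
  set m := Fintype.card ι
  let π : (ι → Fin B) → ι → Fin q := fun d i => ⟨d i % q, Nat.mod_lt _ hq⟩
  have hq' : (0 : ℝ) < q := by exact_mod_cast hq
  have hB' : (0 : ℝ) < B := by exact_mod_cast hq.trans_le hqB
  have hcard : ∀ s : ι → Fin q, (B / q) ^ m ≤ (univ.filter fun d => π d = s).card := by
    intro s
    have : (univ.filter fun d => π d = s) =
        Fintype.piFinset fun i => univ.filter fun d : Fin B => (d : ℕ) % q = s i := by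
      ext d
      simp [π, funext_iff, Fin.ext_iff]
    rw [this, Fintype.card_piFinset]
    calc (B / q) ^ m = ∏ _i : ι, B / q := by simp [m]
      _ ≤ _ := prod_le_prod' fun i _ => div_le_card_mod_eq (s i)
  have hsum : ((B / q : ℕ) : ℝ) ^ m * ∑ s, f s ≤ ∑ d, f (π d) := by
    rw [← sum_fiberwise univ π, mul_sum]
    refine sum_le_sum fun s _ => ?_
    rw [sum_congr rfl fun d hd => congrArg f (mem_filter.1 hd).2, sum_const, nsmul_eq_mul]
    exact mul_le_mul_of_nonneg_right (by exact_mod_cast hcard s) (h0 s)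
  have hfloor : 1 - (q / B : ℝ) ≤ ((B / q : ℕ) : ℝ) * q / B := by
    have h1 : (B : ℝ) < ((B / q : ℕ) + 1) * q := by
      exact_mod_cast Nat.lt_mul_of_div_lt (Nat.lt_succ_self _) hq
    rw [le_div_iff₀ hB', sub_mul, div_mul_cancel₀ _ hB'.ne']
    linarith
  have hle : (q / B : ℝ) ≤ 1 := by
    rw [div_le_one hB']; exact_mod_cast hqB
  have hpow : 1 - m * (q / B : ℝ) ≤ (((B / q : ℕ) : ℝ) * q / B) ^ m := by
    have := one_add_mul_le_pow (a := -(q / B : ℝ)) (by linarith) m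
    calc 1 - m * (q / B : ℝ) = 1 + m * -(q / B : ℝ) := by ring
      _ ≤ (1 + -(q / B : ℝ)) ^ m := this
      _ ≤ _ := pow_le_pow_left₀ (by linarith) (by linarith) m
  have hE : 0 ≤ 𝔼 s, f s := expect_nonneg fun s _ => h0 s
  refine (mul_le_mul_of_nonneg_right hpow hE).trans ?_
  rw [Fintype.expect_eq_sum_div_card, Fintype.expect_eq_sum_div_card, Fintype.card_fun,
    Fintype.card_fun, Fintype.card_fin, Fintype.card_fin]
  push_cast
  have hBm : (0 : ℝ) < (B : ℝ) ^ m := pow_pos hB' m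
  have hqm : (0 : ℝ) < (q : ℝ) ^ m := pow_pos hq' m
  rw [le_div_iff₀ hBm]
  refine le_trans (le_of_eq ?_) hsum
  rw [div_pow, mul_pow]
  change _ * (_ / (q : ℝ) ^ m) * _ = _
  field_simp

/-- Reducing uniformly random digits modulo `q` gives an almost uniform tuple. -/
theorem abs_expect_mod_sub_le {ι : Type*} [Fintype ι] [DecidableEq ι] {q B : ℕ} (hq : 0 < q) (hqB : q ≤ B)
    (f : (ι → Fin q) → ℝ) (h0 : ∀ s, 0 ≤ f s) (h1 : ∀ s, f s ≤ 1) :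
    |𝔼 d : ι → Fin B, f (fun i => ⟨d i % q, Nat.mod_lt _ hq⟩) - 𝔼 s, f s| ≤
      Fintype.card ι * (q / B : ℝ) := by
  have : Nonempty (Fin q) := ⟨⟨0, hq⟩⟩
  have : Nonempty (Fin B) := ⟨⟨0, hq.trans_le hqB⟩⟩
  have a1 := expect_mod_ge hq hqB f h0
  -- The lower bound for `1 - f` is the upper bound for `f`.
  have a2 := expect_mod_ge hq hqB (fun s => 1 - f s) fun s => sub_nonneg.2 (h1 s)
  have e0 : 0 ≤ 𝔼 s, f s := expect_nonneg fun s _ => h0 s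
  have e1 : 𝔼 s, f s ≤ 1 := (expect_le_expect fun s _ => h1 s).trans_eq (Fintype.expect_const _)
  rw [expect_sub_distrib, expect_sub_distrib, Fintype.expect_const, Fintype.expect_const] at a2
  have hε : 0 ≤ Fintype.card ι * (q / B : ℝ) := by positivity
  rw [abs_le]
  constructor <;> nlinarith

/-- The digit of `r` in base `B` at the position `n * i + j`, reduced modulo `q`. -/
def digitMod (B n q r i j : ℕ) : ℕ := r / ((B ^ n) ^ i * B ^ j) % B % q

theorem digitMod_lt {B n q r i j : ℕ} (hq : 0 < q) : digitMod B n q r i j < q := Nat.mod_lt _ hq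

/-- The positions `n * i + j` are below `n * n`, so higher digits do not matter. -/
theorem digitMod_mod {B n q r : ℕ} (i j : Fin n) :
    digitMod B n q (r % B ^ (n * n)) i j = digitMod B n q r i j := by
  unfold digitMod
  congr 1
  rw [← pow_mul, ← pow_add]
  have h : n * i + j + 1 ≤ n * n := by
    have h1 : n * (i + 1) ≤ n * n := Nat.mul_le_mul_left _ i.2
    have h2 := j.2
    rw [mul_add] at h1
    omega
  obtain ⟨k, hk⟩ := Nat.exists_eq_add_of_le h
  rw [hk, add_assoc, pow_add _ (n * i + j : ℕ), Nat.mod_mul_right_div_self, pow_add B 1 k, pow_one,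
    Nat.mod_mul_right_mod]

/-- One tape serves for setup (its remainder modulo `A`) and for the pads (digits of its quotient).
The tape has `M ≥ n * n` digits because its length is a polynomial, which only bounds the number of
pads. -/
theorem abs_expect_digitMod_sub_le {A B M n K : ℕ} (hA : 0 < A) (hK : K = B ^ M * A) (hM : n * n ≤ M)
    {q : Fin A → ℕ} (hq : ∀ ρ, 0 < q ρ) (ε : ℝ) (hqB : ∀ ρ, q ρ ≤ B)
    (hε : ∀ ρ, (n * n : ℝ) * (q ρ / B) ≤ ε)
    (f : (ρ : Fin A) → (Fin n → Fin n → Fin (q ρ)) → ℝ) (h0 : ∀ ρ s, 0 ≤ f ρ s)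
    (h1 : ∀ ρ s, f ρ s ≤ 1) (g : ℕ → ℕ → ℝ)
    (hg : ∀ (ρ : Fin A) r, g ρ r = f ρ fun i j => ⟨digitMod B n (q ρ) r i j, digitMod_lt (hq ρ)⟩) :
    |𝔼 r : Fin K, g (r % A) (r / A) - 𝔼 ρ, 𝔼 s, f ρ s| ≤ ε := by
  subst hK
  have : Nonempty (Fin A) := ⟨⟨0, hA⟩⟩
  rw [expect_fin_mul, ← expect_sub_distrib]
  refine (abs_expect_le _ _).trans ?_
  refine (expect_le_expect fun ρ _ => ?_).trans_eq (Fintype.expect_const ε)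
  -- The surplus digits average out.
  have e1 : 𝔼 r : Fin (B ^ M), g ρ r = 𝔼 r : Fin (B ^ (n * n)), g ρ r := by
    have : Nonempty (Fin (B ^ (M - n * n))) :=
      ⟨⟨0, pow_pos ((hq ρ).trans_le (hqB ρ)) _⟩⟩
    have h := expect_fin_mul (a := B ^ (n * n)) (b := B ^ (M - n * n)) fun i _ => g ρ i
    simp only [Fintype.expect_const] at h
    rw [← h, ← pow_add, Nat.sub_add_cancel hM]
    refine expect_congr rfl fun r _ => ?_
    rw [hg, hg]
    congr 1
    funext i j
    exact Fin.ext (digitMod_mod i j).symm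
  have e2 := abs_expect_mod_sub_le (ι := Fin n × Fin n) (hq ρ) (hqB ρ)
    (fun s => f ρ fun i j => s (i, j)) (fun _ => h0 _ _) fun _ => h1 _ _
  have e3 : 𝔼 s : Fin n × Fin n → Fin (q ρ), f ρ (fun i j => s (i, j)) = 𝔼 s, f ρ s :=
    Fintype.expect_equiv (Equiv.curry _ _ _) _ _ fun s => rfl
  have e4 : 𝔼 r : Fin (B ^ (n * n)), g ρ r = 𝔼 d : Fin n × Fin n → Fin B,
      f ρ (fun i j => ⟨d (i, j) % q ρ, Nat.mod_lt _ (hq ρ)⟩) := by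
    rw [← expect_digits fun d => f ρ (fun i j => ⟨d (i, j) % q ρ, Nat.mod_lt _ (hq ρ)⟩)]
    exact expect_congr rfl fun r _ => hg _ _
  rw [e1, e4, ← e3]
  refine e2.trans ((le_of_eq ?_).trans (hε ρ))
  simp

end Expect

theorem toReal_uniform_bind {α β : Type*} [Fintype α] [Nonempty α] (F : α → PMF β) (b : β) :
    (((PMF.uniformOfFintype α).bind F) b).toReal = 𝔼 a, (F a b).toReal := by
  rw [PMF.bind_apply, tsum_fintype, ENNReal.toReal_sum fun a _ =>
    ENNReal.mul_ne_top (PMF.apply_ne_top _ _) (PMF.apply_ne_top _ _),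
    Fintype.expect_eq_sum_div_card, Finset.sum_div]
  refine Finset.sum_congr rfl fun a _ => ?_
  rw [PMF.uniformOfFintype_apply, ENNReal.toReal_mul, ENNReal.toReal_inv, ENNReal.toReal_natCast,
    mul_comm, div_eq_mul_inv]

namespace NonuniformPPT

variable (D : NonuniformPPT) (κ : ℕ)

theorem acceptProb_uniform_bind {α : Type*} [Fintype α] [Nonempty α] (F : α → PMF Val) :
    D.acceptProb κ ((PMF.uniformOfFintype α).bind F) = 𝔼 a, D.acceptProb κ (F a) := by
  rw [acceptProb, PMF.bind_bind, toReal_uniform_bind]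
  rfl

theorem acceptProb_uniform_map {α : Type*} [Fintype α] [Nonempty α] (F : α → Val) :
    D.acceptProb κ ((PMF.uniformOfFintype α).map F) = 𝔼 a, D.acceptProb κ (PMF.pure (F a)) := by
  rw [← PMF.bind_pure_comp, acceptProb_uniform_bind]
  rfl

theorem acceptProb_nonneg (X : PMF Val) : 0 ≤ D.acceptProb κ X := ENNReal.toReal_nonneg

theorem acceptProb_le_one (X : PMF Val) : D.acceptProb κ X ≤ 1 :=
  ENNReal.toReal_le_of_le_ofReal zero_le_one (by simpa using PMF.coe_le_one (X.bind _) _)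

open Classical in
theorem acceptProb_pure (v : Val) : D.acceptProb κ (PMF.pure v) =
    𝔼 r, if D.outputWithAdvice κ r v = .num 1 then 1 else 0 := by
  rw [acceptProb, PMF.pure_bind, PPT.dist, ← PMF.bind_pure_comp, toReal_uniform_bind]
  refine Finset.expect_congr rfl fun r _ => ?_
  simp only [Function.comp, PMF.pure_apply, outputWithAdvice, eq_comm (a := Val.num 1)]
  rw [apply_ite ENNReal.toReal]; rfl

end NonuniformPPT

/-! ### Numerical conditionals, and decoding of lists and integers. -/

namespace PolyTime

variable {f g F G : Val → ℕ}

theorem num_ite_zero (hf : PolyTime fun v => num (f v)) (hF : PolyTime fun v => num (F v))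
    (hG : PolyTime fun v => num (G v)) : PolyTime fun v => num (if f v = 0 then F v else G v) :=
  (ite_zero hf hF hG).congr fun _ => apply_ite num _ _ _

theorem num_ite_eq (hf : PolyTime fun v => num (f v)) (hg : PolyTime fun v => num (g v))
    (hF : PolyTime fun v => num (F v)) (hG : PolyTime fun v => num (G v)) :
    PolyTime fun v => num (if f v = g v then F v else G v) :=
  (ite_eq hf hg hF hG).congr fun _ => apply_ite num _ _ _

theorem num_ite_lt (hf : PolyTime fun v => num (f v)) (hg : PolyTime fun v => num (g v))
    (hF : PolyTime fun v => num (F v)) (hG : PolyTime fun v => num (G v)) :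
    PolyTime fun v => num (if f v < g v then F v else G v) :=
  (ite_lt hf hg hF hG).congr fun _ => apply_ite num _ _ _

theorem sq (hf : PolyTime fun v => num (f v)) : PolyTime fun v => num (f v ^ 2) :=
  (hf.mul hf).congr fun _ => by rw [_root_.sq]

end PolyTime

namespace Val

theorem entry_ofList (l : List Val) (i : ℕ) (h : i < l.length) : (ofList l).entry i = l[i] := by
  induction l generalizing i with
  | nil => simp at h
  | cons a l ih =>
    cases i with
    | zero => rfl
    | succ i => exact ih i (by simpa using h)

theorem entry_ofTuple {n : ℕ} (g : Fin n → Val) (i : Fin n) : (ofTuple g).entry i = g i := by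
  rw [ofTuple, entry_ofList _ _ (by simp)]
  simp

theorem toInt_ofInt (x : ℤ) : (ofInt x).toInt = x := by
  unfold ofInt
  by_cases h : x < 0
  · rw [if_pos h]
    change -(x.natAbs : ℤ) = x
    omega
  · rw [if_neg h]
    change (x.natAbs : ℤ) = x
    omega

theorem map_range_eq_ofFn {α : Type*} (n : ℕ) (g : ℕ → α) :
    (List.range n).map g = List.ofFn fun i : Fin n => g i :=
  List.ext_getElem (by simp) (by simp)

end Val

/-! The program of the simulator. Its state is a list with the entries: the sum of all inputs,
the list of the flags that mark the corrupted users, the list of their inputs, `N`, `q`, the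
coins for key generation, the base `B` in which these are read, `B ^ n`, the hash value, and its
inverse. Users are represented by powers of two. -/

namespace Sim

/-- The list of all users. -/
def users (e : Val) : Val :=
  ofList ((List.range (e.entry 1).toList.length).map fun i => num (2 ^ i))

/-- Entry 7 is `B ^ n`, so the divisor is `B` to the power `n` times the first index plus the
second, as in `digitMod`. -/
def share (e i j : Val) : ℕ :=
  if i.toNat = j.toNat then 0
  else (e.entry 5).toNat / ((e.entry 7).toNat ^ Nat.log 2 i.toNat *
    (e.entry 6).toNat ^ Nat.log 2 j.toNat) % (e.entry 6).toNat % (e.entry 4).toNat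

def sentShares (e i : Val) : Val := ofList ((users e).toList.map fun j => num (share e i j))

def receivedShares (e i : Val) : Val := ofList ((users e).toList.map fun j => num (share e j i))

def sentSum (e i : Val) : ℕ := ((users e).toList.map fun j => share e i j).sum

def receivedSum (e i : Val) : ℕ := ((users e).toList.map fun j => share e j i).sum

/-- A natural number that is congruent modulo `N` to an encoded integer. -/
def residue (N : ℕ) (x : Val) : ℕ :=
  if x.fst.toNat = 0 then x.snd.toNat else (N - 1) * x.snd.toNat

def flag (e i : Val) : ℕ := ((e.entry 1).entry (Nat.log 2 i.toNat)).toNat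

/-- The input, modulo `N`, of a user in the simulated execution. -/
def input (e i : Val) : ℕ :=
  if flag e i = 0 then
    -- The sum counts the honest users with smaller index; powers of two are ordered like their
    -- exponents.
    if ((users e).toList.map fun j => if j.toNat < i.toNat then 1 - flag e j else 0).sum = 0 then
      -- The total minus the corrupted inputs, with `N - 1` in the role of `-1`. The entries of
      -- honest users in the list of inputs are `0`.
      residue (e.entry 3).toNat (e.entry 0) + ((e.entry 3).toNat - 1) *
        ((users e).toList.map fun j =>
          residue (e.entry 3).toNat ((e.entry 2).entry (Nat.log 2 j.toNat))).sum
    else 0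
  else residue (e.entry 3).toNat ((e.entry 2).entry (Nat.log 2 i.toNat))

/-- Modulo `N ^ 2`, the power `(1 + N) ^ x` is `1 + x * N`. The key is a difference of natural
numbers, so the hash value is raised to the sum sent and its inverse to the sum received. The form
`N ^ 2 - 1 + 1` matches `PolyTime.pow_mod`. -/
def mask (e i : Val) : ℕ :=
  (1 + input e i * (e.entry 3).toNat) *
    ((e.entry 8).toNat ^ sentSum e i % ((e.entry 3).toNat ^ 2 - 1 + 1)) *
    ((e.entry 9).toNat ^ receivedSum e i % ((e.entry 3).toNat ^ 2 - 1 + 1)) %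
    (e.entry 3).toNat ^ 2

def keys (e i : Val) : Val :=
  if flag e i = 0 then num 0 else .pair (sentShares e i) (receivedShares e i)

def allKeys (e : Val) : Val := ofList ((users e).toList.map fun i => keys e i)

def allMasks (e : Val) : Val := ofList ((users e).toList.map fun i => num (mask e i))

section PolyTime

variable {e i j : Val → Val}

theorem users_polyTime (he : PolyTime e) : PolyTime fun v => users (e v) := (he.entry 1).range

theorem share_polyTime (he : PolyTime e) (hi : PolyTime i) (hj : PolyTime j) :
    PolyTime fun v => num (share (e v) (i v) (j v)) :=
  hi.toNat.num_ite_eq hj.toNat (.const (num 0))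
    (((((he.entry 5).toNat.div (((he.entry 7).toNat.pow_log hi.toNat).mul
      ((he.entry 6).toNat.pow_log hj.toNat))).mod (he.entry 6).toNat)).mod (he.entry 4).toNat)

theorem sentShares_polyTime (he : PolyTime e) (hi : PolyTime i) :
    PolyTime fun v => sentShares (e v) (i v) :=
  PolyTime.map (F := fun c j => num (share c.fst c.snd j))
    (share_polyTime PolyTime.id.fst.fst PolyTime.id.fst.snd PolyTime.id.snd) (he.pair hi)
    (users_polyTime he)

theorem receivedShares_polyTime (he : PolyTime e) (hi : PolyTime i) :
    PolyTime fun v => receivedShares (e v) (i v) :=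
  PolyTime.map (F := fun c j => num (share c.fst j c.snd))
    (share_polyTime PolyTime.id.fst.fst PolyTime.id.snd PolyTime.id.fst.snd) (he.pair hi)
    (users_polyTime he)

theorem sentSum_polyTime (he : PolyTime e) (hi : PolyTime i) :
    PolyTime fun v => num (sentSum (e v) (i v)) :=
  PolyTime.sum (F := fun c j => share c.fst c.snd j)
    (share_polyTime PolyTime.id.fst.fst PolyTime.id.fst.snd PolyTime.id.snd) (he.pair hi)
    (users_polyTime he)

theorem receivedSum_polyTime (he : PolyTime e) (hi : PolyTime i) :
    PolyTime fun v => num (receivedSum (e v) (i v)) :=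
  PolyTime.sum (F := fun c j => share c.fst j c.snd)
    (share_polyTime PolyTime.id.fst.fst PolyTime.id.snd PolyTime.id.fst.snd) (he.pair hi)
    (users_polyTime he)

theorem residue_polyTime {N : Val → ℕ} (hN : PolyTime fun v => num (N v)) (he : PolyTime e) :
    PolyTime fun v => num (residue (N v) (e v)) :=
  he.fst.toNat.num_ite_zero he.snd.toNat ((hN.sub (.const (num 1))).mul he.snd.toNat)

theorem flag_polyTime (he : PolyTime e) (hi : PolyTime i) :
    PolyTime fun v => num (flag (e v) (i v)) :=
  (hi.toNat.entry_log (he.entry 1)).toNat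

theorem input_polyTime (he : PolyTime e) (hi : PolyTime i) :
    PolyTime fun v => num (input (e v) (i v)) := by
  have h1 := PolyTime.sum
    (F := fun c j => if j.toNat < c.snd.toNat then 1 - flag c.fst j else 0)
    (PolyTime.id.snd.toNat.num_ite_lt PolyTime.id.fst.snd.toNat
      ((PolyTime.const (num 1)).sub (flag_polyTime PolyTime.id.fst.fst PolyTime.id.snd))
      (.const (num 0))) (he.pair hi) (users_polyTime he)
  have h2 := PolyTime.sum
    (F := fun c j => residue (c.entry 3).toNat ((c.entry 2).entry (Nat.log 2 j.toNat)))
    (residue_polyTime (PolyTime.id.fst.entry 3).toNat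
      (PolyTime.id.snd.toNat.entry_log (PolyTime.id.fst.entry 2))) he (users_polyTime he)
  have hN := (he.entry 3).toNat
  exact (flag_polyTime he hi).num_ite_zero
    (h1.num_ite_zero ((residue_polyTime hN (he.entry 0)).add ((hN.sub (.const (num 1))).mul h2))
      (.const (num 0)))
    (residue_polyTime hN (hi.toNat.entry_log (he.entry 2)))

theorem mask_polyTime (he : PolyTime e) (hi : PolyTime i) :
    PolyTime fun v => num (mask (e v) (i v)) := by
  have hN := (he.entry 3).toNat
  have hM := hN.sq.sub (.const (num 1))
  exact (((((PolyTime.const (num 1)).add ((input_polyTime he hi).mul hN)).mul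
    ((he.entry 8).toNat.pow_mod (sentSum_polyTime he hi) hM)).mul
    ((he.entry 9).toNat.pow_mod (receivedSum_polyTime he hi) hM)).mod hN.sq)

theorem allKeys_polyTime (he : PolyTime e) : PolyTime fun v => allKeys (e v) :=
  PolyTime.map (F := fun e i => keys e i)
    (PolyTime.ite_zero (flag_polyTime PolyTime.id.fst PolyTime.id.snd) (.const (num 0))
      ((sentShares_polyTime PolyTime.id.fst PolyTime.id.snd).pair
        (receivedShares_polyTime PolyTime.id.fst PolyTime.id.snd))) he (users_polyTime he)

theorem allMasks_polyTime (he : PolyTime e) : PolyTime fun v => allMasks (e v) :=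
  PolyTime.map (F := fun e i => num (mask e i))
    (mask_polyTime PolyTime.id.fst PolyTime.id.snd) he (users_polyTime he)

end PolyTime

end Sim

/-! The inputs in the simulated execution -/

/-- Inputs with the same sum as `x`, which agree with `x` at the corrupted users: the first honest
user has the sum of all honest inputs, and the other honest users have `0`. -/
def standIn {n : ℕ} (C : Finset (Option (Fin n))) (x : Fin n → ℤ) (ν : Fin n) : ℤ :=
  if some ν ∈ C then x ν
  else if ∃ μ < ν, some μ ∉ C then 0
  else ∑ μ, if some μ ∈ C then 0 else x μ

theorem standIn_of_mem {n : ℕ} {C : Finset (Option (Fin n))} (x : Fin n → ℤ) {ν : Fin n}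
    (h : some ν ∈ C) : standIn C x ν = x ν := if_pos h

theorem sum_standIn {n : ℕ} (C : Finset (Option (Fin n))) (x : Fin n → ℤ) :
    ∑ ν, standIn C x ν = ∑ ν, x ν := by
  by_cases h : ∃ ν, some ν ∉ C
  · classical
    have hex : (Finset.univ.filter fun ν : Fin n => some ν ∉ C).Nonempty :=
      h.imp fun ν hν => by simpa using hν
    -- `ν₀` is the first honest user, who carries the whole honest sum.
    obtain ⟨ν₀, h0, hmin⟩ := Finset.exists_min_image _ (fun ν => ν) hex
    simp only [Finset.mem_filter, Finset.mem_univ, true_and] at h0 hmin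
    have key : ∀ ν, standIn C x ν = (if some ν ∈ C then x ν else 0) +
        if ν = ν₀ then ∑ μ, (if some μ ∈ C then 0 else x μ) else 0 := by
      intro ν
      unfold standIn
      by_cases hν : some ν ∈ C
      · have : ν ≠ ν₀ := by rintro rfl; exact h0 hν
        simp [hν, this]
      · rw [if_neg hν, if_neg hν, zero_add]
        by_cases he : ν = ν₀
        · subst he
          rw [if_neg, if_pos rfl]
          rintro ⟨μ, hμ, hμC⟩
          exact absurd (hmin μ hμC) (not_le.2 hμ)
        · rw [if_neg he, if_pos ⟨ν₀, lt_of_le_of_ne (hmin ν hν) (Ne.symm he), h0⟩]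
    simp only [key]
    rw [Finset.sum_add_distrib, Finset.sum_ite_eq', if_pos (Finset.mem_univ _),
      ← Finset.sum_add_distrib]
    refine Finset.sum_congr rfl fun ν _ => ?_
    split_ifs <;> simp
  · push Not at h
    exact Finset.sum_congr rfl fun ν _ => standIn_of_mem x (h ν)

/-- Needed so that the challenge fits into advice of polynomial length. -/
theorem abs_standIn_le {n : ℕ} (C : Finset (Option (Fin n))) {x : Fin n → ℤ} {b : ℤ}
    (hx : ∀ ν, |x ν| ≤ b) (ν : Fin n) : |standIn C x ν| ≤ n * b := by
  have hb : 0 ≤ b := (abs_nonneg _).trans (hx ν)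
  have hn : (1 : ℤ) ≤ n := by exact_mod_cast ν.pos
  unfold standIn
  split_ifs
  · exact (hx ν).trans (by nlinarith)
  · simpa using by positivity
  · refine (Finset.abs_sum_le_sum_abs _ _).trans ?_
    refine (Finset.sum_le_card_nsmul _ _ b fun μ _ => ?_).trans_eq (by simp)
    split_ifs
    · simpa using hb
    · exact hx μ

/-! Correctness of the program -/

namespace Sim

/-- The state of the simulator. -/
def state (z : ℤ) (flags inputs : Val) (N q r B b h g : ℕ) : Val :=
  ofList [ofInt z, flags, inputs, num N, num q, num r, num B, num b, num h, num g]

theorem residue_ofInt {N : ℕ} (hN : 0 < N) (x : ℤ) : (residue N (ofInt x) : ZMod N) = x := by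
  unfold residue ofInt
  simp only [fst_pair, snd_pair, toNat_num]
  by_cases h : x < 0
  · simp only [h, if_true, one_ne_zero, if_false]
    have : (x : ZMod N) = -(x.natAbs : ℕ) := by
      have h2 : x = -(x.natAbs : ℤ) := by omega
      have h3 := congrArg (Int.cast : ℤ → ZMod N) h2
      rwa [Int.cast_neg, Int.cast_natCast] at h3
    rw [this]
    push_cast [Nat.cast_sub (show 1 ≤ N from hN)]
    simp
  · simp only [h, if_false, if_true]
    have h2 : x = (x.natAbs : ℤ) := by omega
    conv_rhs => rw [h2]
    simp

theorem residue_zero (N : ℕ) : residue N (num 0) = 0 := rfl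

end Sim

section Correct

variable (Φ : Scheme) {P : Params} {n : ℕ} (C : Finset (Option (Fin n))) (x : Fin n → ℤ)
  (t r B : ℕ)

/-- The state of the simulator for given parameters and inputs. -/
def simState (P : Params) : Val :=
  Sim.state (∑ ν, x ν) (.ofTuple fun ν : Fin n => num (if some ν ∈ C then 1 else 0))
    (Scheme.coalitionInputs C x) P.N P.q r B (B ^ n) (Φ.hash P t : ZMod (P.N ^ 2)).val
    (modInv (Φ.hash P t : ZMod (P.N ^ 2)).val (P.N ^ 2))

/-- The pads that the simulator chooses. -/
def simPads (n B r : ℕ) (P : Params) : Pads n P :=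
  fun ν μ => ⟨digitMod B n P.q r ν μ, digitMod_lt P.q_pos⟩

theorem toList_users_simState : (Sim.users (simState Φ C x t r B P)).toList =
    List.ofFn fun ν : Fin n => num (2 ^ (ν : ℕ)) := by
  rw [Sim.users, toList_ofList]
  change (List.range (Val.toList (.ofTuple _)).length).map _ = _
  rw [toList_ofTuple, List.length_ofFn, map_range_eq_ofFn]

theorem share_simState (ν μ : Fin n) :
    Sim.share (simState Φ C x t r B P) (num (2 ^ (ν : ℕ))) (num (2 ^ (μ : ℕ))) =
      share (simPads n B r P) ν μ := by
  unfold Sim.share share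
  simp only [toNat_num, Nat.log_pow one_lt_two]
  refine if_congr ?_ rfl rfl
  rw [Fin.ext_iff]
  exact ⟨fun h => Nat.pow_right_injective le_rfl h, fun h => by rw [h]⟩

theorem flag_simState (ν : Fin n) : Sim.flag (simState Φ C x t r B P) (num (2 ^ (ν : ℕ))) =
    if some ν ∈ C then 1 else 0 := by
  rw [Sim.flag, toNat_num, Nat.log_pow one_lt_two]
  change (Val.entry _ (.ofTuple _)).toNat = _
  rw [entry_ofTuple]; rfl

theorem map_users_simState {α : Type*} (g : Val → α) :
    (Sim.users (simState Φ C x t r B P)).toList.map g =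
      List.ofFn fun ν : Fin n => g (num (2 ^ (ν : ℕ))) := by
  rw [toList_users_simState, List.map_ofFn]; rfl

theorem sentShares_simState (ν : Fin n) :
    Sim.sentShares (simState Φ C x t r B P) (num (2 ^ (ν : ℕ))) =
      .ofTuple fun μ => num (share (simPads n B r P) ν μ) := by
  rw [Sim.sentShares, map_users_simState]
  simp only [share_simState]; rfl

theorem receivedShares_simState (ν : Fin n) :
    Sim.receivedShares (simState Φ C x t r B P) (num (2 ^ (ν : ℕ))) =
      .ofTuple fun μ => num (share (simPads n B r P) μ ν) := by
  rw [Sim.receivedShares, map_users_simState]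
  simp only [share_simState]; rfl

theorem allKeys_simState : Val.pair P.encode (Sim.allKeys (simState Φ C x t r B P)) =
    Scheme.keyView P (simPads n B r P) C := by
  rw [Sim.allKeys, map_users_simState, Scheme.keyView, Scheme.restrict, ofTuple]
  refine congrArg (fun l => Val.pair P.encode (ofList (List.ofFn l))) (funext fun ν => ?_)
  rw [Sim.keys, flag_simState, sentShares_simState, receivedShares_simState]
  split_ifs <;> simp_all

theorem Params.N_pos (P : Params) : 0 < P.N := by
  obtain ⟨a, b, ha, hb, -, h⟩ := P.rsa
  rw [h]; exact Nat.mul_pos ha.pos hb.pos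

theorem Params.one_lt_N (P : Params) : 1 < P.N := by
  obtain ⟨a, b, ha, hb, -, h⟩ := P.rsa
  rw [h]
  nlinarith [ha.two_le, hb.two_le]

theorem input_simState (ν : Fin n) :
    (Sim.input (simState Φ C x t r B P) (num (2 ^ (ν : ℕ))) : ZMod P.N) = (standIn C x ν : ℤ) := by
  have hN := P.N_pos
  have hentry : ∀ μ : Fin n, ((simState Φ C x t r B P).entry 2).entry (Nat.log 2 (2 ^ (μ : ℕ))) =
      if some μ ∈ C then ofInt (x μ) else num 0 := fun μ => by
    rw [Nat.log_pow one_lt_two]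
    exact entry_ofTuple _ μ
  have hNe : ((simState Φ C x t r B P).entry 3).toNat = P.N := rfl
  have hz : (simState Φ C x t r B P).entry 0 = ofInt (∑ ν, x ν) := rfl
  unfold Sim.input standIn
  simp only [map_users_simState, flag_simState, hNe, hz, toNat_num, hentry, List.sum_ofFn]
  by_cases hν : some ν ∈ C
  · simp only [hν, if_true, one_ne_zero, if_false]
    exact Sim.residue_ofInt hN _
  · simp only [hν, if_false, if_true]
    have hiff : (∑ μ : Fin n, if 2 ^ (μ : ℕ) < 2 ^ (ν : ℕ) then
        1 - (if some μ ∈ C then 1 else 0) else 0) = 0 ↔ ¬ ∃ μ < ν, some μ ∉ C := by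
      rw [Finset.sum_eq_zero_iff]
      simp only [Finset.mem_univ, true_implies, not_exists, not_and, not_not]
      refine forall_congr' fun μ => ?_
      simp only [Nat.pow_lt_pow_iff_right one_lt_two, Fin.lt_def]
      split_ifs <;> simp_all
    rw [if_congr hiff rfl rfl, ite_not]
    split_ifs
    · simp
    · push_cast [Nat.cast_sub (show 1 ≤ P.N from hN)]
      rw [Sim.residue_ofInt hN, ZMod.natCast_self, zero_sub, neg_one_mul, ← sub_eq_add_neg]
      push_cast
      rw [← Finset.sum_sub_distrib]
      refine Finset.sum_congr rfl fun μ _ => ?_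
      split_ifs
      · rw [Sim.residue_ofInt hN]; simp
      · simp [Sim.residue_zero]

theorem mask_simState (ν : Fin n) :
    Sim.mask (simState Φ C x t r B P) (num (2 ^ (ν : ℕ))) =
      (Φ.mask P t (standIn C x ν) (key (simPads n B r P) ν) : ZMod (P.N ^ 2)).val := by
  have hN := P.N_pos
  have hN2 : 1 < P.N ^ 2 := Nat.one_lt_pow two_ne_zero P.one_lt_N
  have hne : NeZero (P.N ^ 2) := ⟨by omega⟩
  set e := simState Φ C x t r B P with he
  set H := Φ.hash P t with hH
  have hNe : (e.entry 3).toNat = P.N := rfl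
  have h8 : (e.entry 8).toNat = (H : ZMod (P.N ^ 2)).val := rfl
  have h9 : (e.entry 9).toNat = modInv (H : ZMod (P.N ^ 2)).val (P.N ^ 2) := rfl
  have hinv : (modInv (H : ZMod (P.N ^ 2)).val (P.N ^ 2) : ZMod (P.N ^ 2)) = (H⁻¹ : P.Grp) := by
    have h := modInv_spec hN2 (ZMod.val_lt _) (ZMod.val_coe_unit_coprime H)
    push_cast at h
    rw [ZMod.natCast_zmod_val] at h
    exact (Units.inv_eq_of_mul_eq_one_right h).symm
  -- The program knows the input only modulo `N`; this suffices, since the factor `N` kills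
  -- multiples of `N` modulo `N ^ 2`.
  have hx : (Sim.input e (num (2 ^ (ν : ℕ))) : ZMod (P.N ^ 2)) * P.N =
      ((standIn C x ν : ℤ) : ZMod (P.N ^ 2)) * P.N := by
    have h1 := input_simState Φ (P := P) C x t r B ν
    have h2 : ((P.N : ℤ) : ℤ) ∣ (Sim.input e (num (2 ^ (ν : ℕ))) : ℤ) - standIn C x ν := by
      rw [← ZMod.intCast_zmod_eq_zero_iff_dvd]
      push_cast
      rw [h1, sub_self]
    obtain ⟨k, hk⟩ := h2
    have h3 : ((P.N : ZMod (P.N ^ 2))) ^ 2 = 0 := by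
      exact_mod_cast ZMod.natCast_self (P.N ^ 2)
    have h4 := congrArg (Int.cast : ℤ → ZMod (P.N ^ 2)) hk
    push_cast at h4
    linear_combination (P.N : ZMod (P.N ^ 2)) * h4 + (k : ZMod (P.N ^ 2)) * h3
  have hs : Sim.sentSum e (num (2 ^ (ν : ℕ))) = ∑ μ, share (simPads n B r P) ν μ := by
    rw [Sim.sentSum, map_users_simState, List.sum_ofFn]
    exact Finset.sum_congr rfl fun μ _ => share_simState Φ C x t r B ν μ
  have hr : Sim.receivedSum e (num (2 ^ (ν : ℕ))) = ∑ μ, share (simPads n B r P) μ ν := by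
    rw [Sim.receivedSum, map_users_simState, List.sum_ofFn]
    exact Finset.sum_congr rfl fun μ _ => share_simState Φ C x t r B μ ν
  have hkey : key (simPads n B r P) ν =
      (Sim.sentSum e (num (2 ^ (ν : ℕ))) : ℤ) - Sim.receivedSum e (num (2 ^ (ν : ℕ))) := by
    rw [hs, hr, key, Finset.sum_sub_distrib]; push_cast; rfl
  have hmask : (Φ.mask P t (standIn C x ν) (key (simPads n B r P) ν) : ZMod (P.N ^ 2)) =
      (((1 + Sim.input e (num (2 ^ (ν : ℕ))) * P.N) *
        ((H : ZMod (P.N ^ 2)).val ^ Sim.sentSum e (num (2 ^ (ν : ℕ))) % P.N ^ 2) *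
        (modInv (H : ZMod (P.N ^ 2)).val (P.N ^ 2) ^ Sim.receivedSum e (num (2 ^ (ν : ℕ))) %
          P.N ^ 2) : ℕ) : ZMod (P.N ^ 2)) := by
    rw [Scheme.mask, Units.val_mul, Scheme.coe_onePlusN_zpow, hkey, zpow_sub, zpow_natCast,
      zpow_natCast, ← inv_pow]
    rw [Nat.cast_mul, Nat.cast_mul, ZMod.natCast_mod, ZMod.natCast_mod]
    push_cast
    rw [hx, hinv, ZMod.natCast_zmod_val, mul_assoc]
  rw [hmask, ZMod.val_natCast, Sim.mask, hNe, h8, h9, Nat.sub_add_cancel hN2.le]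

theorem allMasks_simState : Sim.allMasks (simState Φ C x t r B P) =
    Φ.maskedValues P (simPads n B r P) t (standIn C x) := by
  rw [Sim.allMasks, map_users_simState, Scheme.maskedValues, ofTuple]
  simp only [mask_simState]

end Correct

/-! ### The simulator as a single algorithm. -/

/-- What the coalition sees, for given random choices. -/
def viewValue (Φ : Scheme) {n : ℕ} (P : Params) (s : Pads n P) (C : Finset (Option (Fin n)))
    (t : ℕ) (x y : Fin n → ℤ) : Val :=
  .ofList [num t, Scheme.encodeCoalition C, Scheme.coalitionInputs C x,
      Scheme.keyView P s C, Φ.maskedValues P s t y]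

/-- The simulator: it draws public parameters and pads, and executes the protocol on inputs that
have the prescribed sum. Its coins are first used for the setup; the remaining coins are the
pads, in base `2 ^ b κ`, before the reduction modulo `q`. -/
theorem exists_simulator (Φ : Scheme) (b u : Polynomial ℕ) : ∃ S : PPT,
    S.coins = b * u + Φ.setupCoins ∧
    ∀ (κ : ℕ) (r : Fin (2 ^ S.coins.eval κ)) {n : ℕ} (C : Finset (Option (Fin n))) (t : ℕ)
      (x : Fin n → ℤ) (ρ : Fin (2 ^ Φ.setupCoins.eval κ)),
      (ρ : ℕ) = r % 2 ^ Φ.setupCoins.eval κ →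
      S.output κ r (.ofList [num t, .ofInt (∑ ν, x ν), Scheme.encodeCoalition C,
        Scheme.coalitionInputs C x]) =
      viewValue Φ (Φ.setup κ ρ)
        (simPads n (2 ^ b.eval κ) (r / 2 ^ Φ.setupCoins.eval κ) (Φ.setup κ ρ)) C t x
        (standIn C x) := by
  obtain ⟨fs, hfs, hsetup⟩ := Φ.setup_polyTime
  obtain ⟨fh, hfh, hhash⟩ := Φ.hash_polyTime
  -- The security parameter arrives as `2 ^ κ`, so the logarithm recovers `κ`.
  let A : Val → ℕ := fun v => 2 ^ Φ.setupCoins.eval (Nat.log 2 v.fst.toNat)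
  let B : Val → ℕ := fun v => 2 ^ b.eval (Nat.log 2 v.fst.toNat)
  have hA : PolyTime fun v => num (A v) := .two_pow_polynomial _ PolyTime.id.fst.toNat
  have hB : PolyTime fun v => num (B v) := .two_pow_polynomial _ PolyTime.id.fst.toNat
  let params : Val → Val := fun v => fs (.pair v.fst (num (v.snd.fst.toNat % A v)))
  have hparams : PolyTime params :=
    hfs.comp (PolyTime.id.fst.pair (PolyTime.id.snd.fst.toNat.mod hA))
  let hv : Val → ℕ := fun v => (fh (.pair (params v) (v.snd.snd.entry 0))).toNat
  have hhv : PolyTime fun v => num (hv v) :=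
    (hfh.comp (hparams.pair (PolyTime.id.snd.snd.entry 0))).toNat
  let e : Val → Val := fun v => .ofList [v.snd.snd.entry 1, (v.snd.snd.entry 2).snd,
    v.snd.snd.entry 3, num (params v).fst.toNat, num (params v).snd.fst.toNat,
    num (v.snd.fst.toNat / A v), num (B v),
    -- The number of users is read off from the list of flags describing the coalition.
    num (B v ^ ((v.snd.snd.entry 2).snd).toList.length), num (hv v),
    num (modInv (hv v) ((params v).fst.toNat ^ 2))]
  have he : PolyTime e :=
    (PolyTime.id.snd.snd.entry 1).pair <| (PolyTime.id.snd.snd.entry 2).snd.pair <|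
    (PolyTime.id.snd.snd.entry 3).pair <| hparams.fst.toNat.pair <| hparams.snd.fst.toNat.pair <|
    (PolyTime.id.snd.fst.toNat.div hA).pair <| hB.pair <|
    (hB.pow_length (PolyTime.id.snd.snd.entry 2).snd).pair <| hhv.pair <|
    (hhv.modInv hparams.fst.toNat.sq).pair <| .const (num 0)
  refine ⟨⟨fun v => .ofList [v.snd.snd.entry 0, v.snd.snd.entry 2, v.snd.snd.entry 3,
    .pair (params v) (Sim.allKeys (e v)), Sim.allMasks (e v)], ?_, _⟩, rfl, ?_⟩
  · exact (PolyTime.id.snd.snd.entry 0).pair <| (PolyTime.id.snd.snd.entry 2).pair <|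
      (PolyTime.id.snd.snd.entry 3).pair <| (hparams.pair (Sim.allKeys_polyTime he)).pair <|
      (Sim.allMasks_polyTime he).pair <| .const (num 0)
  · intro κ r n C t x ρ hρ
    simp only [PPT.output]
    set v := Val.pair (secParam κ) (.pair (num r) (.ofList [num t, .ofInt (∑ ν, x ν),
      Scheme.encodeCoalition C, Scheme.coalitionInputs C x])) with hv_def
    have hlog : Nat.log 2 v.fst.toNat = κ := Nat.log_pow one_lt_two κ
    have hAv : A v = 2 ^ Φ.setupCoins.eval κ := by simp only [A, hlog]
    have hBv : B v = 2 ^ b.eval κ := by simp only [B, hlog]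
    have hpv : params v = (Φ.setup κ ρ).encode := by
      rw [← hsetup, hρ, ← hAv]; rfl
    have hhvv : hv v = (Φ.hash (Φ.setup κ ρ) t : ZMod ((Φ.setup κ ρ).N ^ 2)).val := by
      simp only [hv]
      rw [hpv]
      change (fh (.pair _ (num t))).toNat = _
      rw [hhash]; rfl
    have hlen : (Val.toList (v.snd.snd.entry 2).snd).length = n := by
      change (Val.toList (.ofTuple _)).length = n
      rw [toList_ofTuple, List.length_ofFn]
    have hev : e v = simState Φ C x t (r / 2 ^ Φ.setupCoins.eval κ) (2 ^ b.eval κ)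
        (Φ.setup κ ρ) := by
      simp only [e]
      rw [hlen, hhvv, hpv, hAv, hBv]
      rfl
    rw [hev, hpv, allKeys_simState, allMasks_simState]
    rfl

/-! Polynomial bounds and negligible functions -/

namespace PolyBounded

variable {f g : ℕ → ℕ}

theorem mono (hg : PolyBounded g) (h : ∀ κ, f κ ≤ g κ) : PolyBounded f :=
  hg.imp fun _ hP κ => (h κ).trans (hP κ)

theorem const (c : ℕ) : PolyBounded fun _ => c := ⟨Polynomial.C c, fun _ => by simp⟩

theorem add (hf : PolyBounded f) (hg : PolyBounded g) : PolyBounded fun κ => f κ + g κ := by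
  obtain ⟨P, hP⟩ := hf
  obtain ⟨Q, hQ⟩ := hg
  exact ⟨P + Q, fun κ => by simpa using add_le_add (hP κ) (hQ κ)⟩

theorem mul (hf : PolyBounded f) (hg : PolyBounded g) : PolyBounded fun κ => f κ * g κ := by
  obtain ⟨P, hP⟩ := hf
  obtain ⟨Q, hQ⟩ := hg
  exact ⟨P * Q, fun κ => by simpa using Nat.mul_le_mul (hP κ) (hQ κ)⟩

theorem size_pair {a b : ℕ → Val} (ha : PolyBounded fun κ => (a κ).size)
    (hb : PolyBounded fun κ => (b κ).size) : PolyBounded fun κ => (Val.pair (a κ) (b κ)).size :=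
  (ha.add hb).add (const 1)

theorem size_ofTuple {n : ℕ → ℕ} (hn : PolyBounded n) {a : (κ : ℕ) → Fin (n κ) → Val}
    {β : ℕ → ℕ} (hβ : PolyBounded β) (ha : ∀ κ ν, (a κ ν).size ≤ β κ) :
    PolyBounded fun κ => (Val.ofTuple (a κ)).size := by
  have key : ∀ (m : ℕ) (L : List Val), (∀ v ∈ L, v.size ≤ m) →
      (Val.ofList L).size ≤ L.length * (m + 1) + 1 := by
    intro m L
    induction L with
    | nil => intro _; simp [ofList, size]
    | cons v L ih =>
      intro h
      have h1 := ih fun w hw => h w (List.mem_cons_of_mem _ hw)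
      have h2 := h v List.mem_cons_self
      simp only [ofList, size, List.length_cons, add_mul]
      omega
  refine ((hn.mul (hβ.add (const 1))).add (const 1)).mono fun κ => ?_
  refine (key (β κ) _ ?_).trans (by simp)
  intro v hv
  obtain ⟨ν, rfl⟩ := (List.mem_ofFn' _ _).1 hv
  exact ha κ ν

end PolyBounded

theorem size_ofInt_le {x : ℤ} {b : ℕ} (h : |x| < 2 ^ b) : (ofInt x).size ≤ b + 4 := by
  have h1 : Nat.size x.natAbs ≤ b := by
    rw [Nat.size_le]
    zify
    exact h
  have h2 : Nat.size (if x < 0 then 1 else 0) ≤ 1 := by split <;> simp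
  simp only [ofInt, size]
  omega

theorem negligible_polynomial_div_two_pow (P : Polynomial ℕ) :
    Negligible fun κ => ((P.eval κ : ℕ) : ℝ) / 2 ^ κ := by
  have h : SuperpolynomialDecay atTop (fun κ : ℕ => (κ : ℝ)) fun κ : ℕ => ((1 / 2 : ℝ)) ^ κ :=
    fun k => tendsto_pow_const_mul_const_pow_of_abs_lt_one k (by norm_num [abs_lt])
  refine (h.polynomial_mul (P.map (Nat.castRingHom ℝ))).congr fun κ => ?_
  rw [Polynomial.eval_natCast_map]
  simp [div_eq_mul_inv]

/-! The reduction to the data publishing game -/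

theorem isTimeDomain_empty (Φ : Scheme) : Φ.IsTimeDomain fun _ => ∅ :=
  ⟨fun _ => Set.empty_subset _, fun _ => num 0, fun _ => num 0, .const _, .const _,
    fun κ t => by simp⟩

theorem polyBounded_size_time {Φ : Scheme} {t : ℕ → ℕ} (ht : ∀ κ, t κ ∈ Φ.times κ) :
    PolyBounded fun κ => (num (t κ)).size := by
  obtain ⟨τ, hτ, h⟩ := Φ.times_bounded
  refine (hτ.add (.const 1)).mono fun κ => ?_
  simpa [size] using Nat.size_le.2 (h κ _ (ht κ))

/-- The advice is the time itself, and membership is a test for equality. -/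
theorem isTimeDomain_singleton {Φ : Scheme} {t : ℕ → ℕ} (ht : ∀ κ, t κ ∈ Φ.times κ) :
    Φ.IsTimeDomain fun κ => {t κ} := by
  refine ⟨fun κ => Set.singleton_subset_iff.2 (ht κ), _, fun κ => num (t κ),
    PolyTime.id.snd.snd.toNat.num_ite_eq PolyTime.id.snd.fst.toNat (.const (num 1))
      (.const (num 0)), polyBounded_size_time ht, fun κ t' => ?_⟩
  simp only [fst_pair, snd_pair, toNat_num, Set.mem_singleton_iff]
  split_ifs <;> simp_all

section Reduction

variable {Φ : Scheme} (C : Φ.Coalition) (t : ℕ → ℕ) (x y : (κ : ℕ) → Fin (Φ.users κ) → ℤ)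

/-- What the coalition sees if the inputs of the honest users are replaced by those in `y`. -/
def viewWith (κ : ℕ) : PMF Val :=
  (PMF.uniformOfFintype (Fin (2 ^ Φ.setupCoins.eval κ))).bind fun ρ =>
  (PMF.uniformOfFintype (Pads (Φ.users κ) (Φ.setup κ ρ))).map fun s =>
    viewValue Φ (Φ.setup κ ρ) s (C κ) (t κ) (x κ) (y κ)

theorem acceptProb_viewWith (D : NonuniformPPT) (κ : ℕ) :
    D.acceptProb κ (viewWith C t x y κ) = 𝔼 ρ, 𝔼 s, D.acceptProb κ
      (PMF.pure (viewValue Φ (Φ.setup κ ρ) s (C κ) (t κ) (x κ) (y κ))) := by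
  rw [viewWith, D.acceptProb_uniform_bind]
  exact Finset.expect_congr rfl fun ρ _ => D.acceptProb_uniform_map κ _

/-- The adversary that submits `(y, x)` as its challenge, and asks `D` about the resulting view.
Its advice consists of that of `D`, of the challenge, and of the known parts of the view. -/
def distinguishingRun (D : NonuniformPPT) (v : Val) : Val :=
  -- The history starts with the key view alone, and then the challenge is due; a second entry is
  -- the answer to the challenge, and then the guess is due.
  if (Op.isPair.apply v.snd.snd.snd.snd).toNat = 0 then v.snd.snd.fst.entry 1
  else D.run (.pair v.fst (.pair v.snd.fst (.pair (v.snd.snd.fst.entry 0)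
    (.ofList [v.snd.snd.fst.entry 2, v.snd.snd.fst.entry 3, v.snd.snd.fst.entry 4,
      v.snd.snd.snd.entry 0, v.snd.snd.snd.entry 1]))))

theorem distinguishingRun_polyTime (D : NonuniformPPT) : PolyTime (distinguishingRun D) := by
  have ha := PolyTime.id.snd.snd.fst
  have hh := PolyTime.id.snd.snd.snd
  exact PolyTime.ite_zero ((PolyTime.op .isPair).comp hh.snd).toNat (ha.entry 1)
    (D.polyTime.comp <| PolyTime.id.fst.pair <| PolyTime.id.snd.fst.pair <| (ha.entry 0).pair <|
      (ha.entry 2).pair <| (ha.entry 3).pair <| (ha.entry 4).pair <| (hh.entry 0).pair <|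
      (hh.entry 1).pair <| .const (num 0))

def distinguishingAdvice (D : NonuniformPPT) (κ : ℕ) : Val :=
  .ofList [D.advice κ, .pair (num (t κ)) (.pair (.ofTuple fun ν => ofInt (y κ ν))
    (.ofTuple fun ν => ofInt (x κ ν))), num (t κ), Scheme.encodeCoalition (C κ),
    Scheme.coalitionInputs (C κ) (x κ)]

theorem polyBounded_distinguishingAdvice (D : NonuniformPPT) (ht : ∀ κ, t κ ∈ Φ.times κ)
    {β : ℕ → ℕ} (hβ : PolyBounded β) (hx : ∀ κ ν, |x κ ν| < 2 ^ β κ)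
    (hy : ∀ κ ν, |y κ ν| < 2 ^ β κ) :
    PolyBounded fun κ => (distinguishingAdvice C t x y D κ).size := by
  have ht' := polyBounded_size_time ht
  have hβ' := hβ.add (.const 4)
  have hn := Φ.users_bounded
  refine D.advice_bounded.size_pair <| (ht'.size_pair <|
    (PolyBounded.size_ofTuple hn hβ' fun κ ν => size_ofInt_le (hy κ ν)).size_pair <|
    PolyBounded.size_ofTuple hn hβ' fun κ ν => size_ofInt_le (hx κ ν)).size_pair <|
    ht'.size_pair <| PolyBounded.size_pair (.size_pair ?_ ?_) <| .size_pair ?_ (.const _)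
  · refine (PolyBounded.const 2).mono fun κ => ?_
    split_ifs <;> simp [size]
  · refine PolyBounded.size_ofTuple hn (.const 2) fun κ ν => ?_
    split_ifs <;> simp [size]
  · refine PolyBounded.size_ofTuple hn hβ' fun κ ν => ?_
    split_ifs
    · exact size_ofInt_le (hx κ ν)
    · simp [size]

variable {C t x y}

theorem compIndist_viewWith (hmask : Φ.IsINDCPA) (hC : Φ.IsLogSize C)
    (ht : ∀ κ, t κ ∈ Φ.times κ) {β : ℕ → ℕ} (hβ : PolyBounded β)
    (hx : ∀ κ ν, |x κ ν| < 2 ^ β κ) (hy : ∀ κ ν, |y κ ν| < 2 ^ β κ)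
    (hsum : ∀ κ, ∑ ν, y κ ν = ∑ ν, x κ ν) (hagree : ∀ κ ν, some ν ∈ C κ → y κ ν = x κ ν) :
    CompIndist (viewWith C t x y) (viewWith C t x x) := by
  classical
  intro D
  let 𝒜 : Φ.MaskAdversary :=
    { run := distinguishingRun D
      polyTime := distinguishingRun_polyTime D
      coins := D.coins
      advice := distinguishingAdvice C t x y D
      advice_bounded := polyBounded_distinguishingAdvice C t x y D ht hβ hx hy
      coalition := C
      queries₁ := 0
      queries₂ := 0 }
  -- No queries are made, so both query domains can be empty, and disjointness is automatic.
  have hneg := hmask (fun _ => ∅) (fun _ => ∅) (fun κ => {t κ}) (isTimeDomain_empty Φ)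
    (isTimeDomain_empty Φ) (isTimeDomain_singleton ht) (by simp) (by simp) (by simp) 𝒜 hC
  have hguess : ∀ (κ : ℕ) (P : Params) (s : Pads (Φ.users κ) P) (r : Fin (2 ^ D.coins.eval κ))
      (b : Bool), 𝒜.guess (fun _ => ∅) (fun _ => ∅) (fun κ => {t κ}) κ P s r b =
      decide ((D.outputWithAdvice κ r (viewValue Φ P s (C κ) (t κ) (x κ)
        (if b then x κ else y κ))) = num 1) := by
    intro κ P s r b
    have hread : ∀ z : Fin (Φ.users κ) → ℤ,
        Scheme.readInputs (Φ.users κ) (.ofTuple fun ν => ofInt (z ν)) = z := fun z => by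
      funext ν
      rw [Scheme.readInputs, entry_ofTuple, toInt_ofInt]
    have hmsg : 𝒜.outputWithAdvice κ r (.ofList [Scheme.keyView P s (C κ)]) =
        .pair (num (t κ)) (.pair (.ofTuple fun ν => ofInt (y κ ν))
          (.ofTuple fun ν => ofInt (x κ ν))) := rfl
    have hans : Scheme.challengeAnswer {t κ} (Φ.maskedValues P s) (C κ) b
        (.pair (num (t κ)) (.pair (.ofTuple fun ν => ofInt (y κ ν))
          (.ofTuple fun ν => ofInt (x κ ν)))) =
        Φ.maskedValues P s (t κ) (if b then x κ else y κ) := by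
      rw [Scheme.challengeAnswer]
      simp only [fst_pair, snd_pair, toNat_num, hread]
      exact if_pos ⟨rfl, hsum κ, hagree κ⟩
    have hfin : ∀ a : Val, 𝒜.outputWithAdvice κ r (.ofList ([Scheme.keyView P s (C κ)] ++ [a])) =
        D.outputWithAdvice κ r (.ofList [num (t κ), Scheme.encodeCoalition (C κ),
          Scheme.coalitionInputs (C κ) (x κ), Scheme.keyView P s (C κ), a]) := fun a => rfl
    have hone : ∀ v : Val, v.toNat = 1 ↔ v = num 1 := by
      rintro (n | _) <;> simp [Val.toNat]
    have hq1 : 𝒜.queries₁.eval κ = 0 := Polynomial.eval_zero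
    have hq2 : 𝒜.queries₂.eval κ = 0 := Polynomial.eval_zero
    have hco : 𝒜.coalition κ = C κ := rfl
    simp only [Scheme.MaskAdversary.guess, hq1, hq2, Scheme.queryPhase, hco]
    rw [hmsg, hans, hfin, decide_eq_decide, hone]
    rfl
  -- The guess is right with probability `(p + (1 - p')) / 2`, where `p` and `p'` are the acceptance
  -- probabilities for the true and for the substituted inputs.
  have hgame : ∀ κ, (𝒜.game (fun _ => ∅) (fun _ => ∅) (fun κ => {t κ}) κ true).toReal - 1 / 2 =
      (D.acceptProb κ (viewWith C t x x κ) - D.acceptProb κ (viewWith C t x y κ)) / 2 := by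
    intro κ
    rw [Scheme.MaskAdversary.game, toReal_uniform_bind, acceptProb_viewWith, acceptProb_viewWith,
      ← Finset.expect_sub_distrib, Finset.expect_div]
    rw [← Fintype.expect_const (ι := Fin (2 ^ Φ.setupCoins.eval κ)) (1 / 2 : ℝ),
      ← Finset.expect_sub_distrib]
    refine Finset.expect_congr rfl fun ρ _ => ?_
    rw [toReal_uniform_bind, ← Finset.expect_sub_distrib, Finset.expect_div,
      ← Fintype.expect_const (ι := Pads (Φ.users κ) (Φ.setup κ ρ)) (1 / 2 : ℝ),
      ← Finset.expect_sub_distrib]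
    refine Finset.expect_congr rfl fun s _ => ?_
    rw [toReal_uniform_bind, D.acceptProb_pure, D.acceptProb_pure, ← Finset.expect_sub_distrib,
      Finset.expect_div, ← Fintype.expect_const (ι := Fin (2 ^ D.coins.eval κ)) (1 / 2 : ℝ),
      ← Finset.expect_sub_distrib]
    refine Finset.expect_congr rfl fun r _ => ?_
    rw [← PMF.bind_pure_comp, toReal_uniform_bind, Fintype.expect_eq_sum_div_card,
      Fintype.sum_bool]
    simp only [Function.comp, PMF.pure_apply, hguess, if_true, Bool.false_eq_true, if_false]
    by_cases h1 : D.outputWithAdvice κ r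
        (viewValue Φ (Φ.setup κ ρ) s (C κ) (t κ) (x κ) (x κ)) = num 1 <;>
      by_cases h2 : D.outputWithAdvice κ r
        (viewValue Φ (Φ.setup κ ρ) s (C κ) (t κ) (x κ) (y κ)) = num 1 <;>
      simp [h1, h2] <;> norm_num
  refine (hneg.const_mul 2).congr fun κ => ?_
  rw [Scheme.MaskAdversary.advantage, hgame, abs_div, abs_sub_comm, abs_two]
  ring

end Reduction

/-! ### Statistical error of the simulation, and conclusion. -/

/-- `q` is part of the output of a polynomial-time setup, so it has polynomially many bits. -/
theorem exists_q_bound (Φ : Scheme) : ∃ Q : Polynomial ℕ, ∀ κ ρ,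
    (Φ.setup κ ρ).q < 2 ^ Q.eval κ := by
  obtain ⟨f, hf, hsetup⟩ := Φ.setup_polyTime
  obtain ⟨P, hP⟩ := hf.size_le
  refine ⟨P.comp (Polynomial.X + Φ.setupCoins + 4), fun κ ρ => ?_⟩
  have h1 := hP (.pair (secParam κ) (num ρ))
  rw [hsetup] at h1
  have h2 : (Val.pair (secParam κ) (num ρ)).size ≤ κ + Φ.setupCoins.eval κ + 4 := by
    have := Nat.size_le.2 ρ.2
    simp only [size, secParam, Nat.size_pow]
    omega
  have h3 := h1.trans (monotone_polynomial_eval P h2)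
  simp only [Params.encode, size] at h3
  rw [← Nat.size_le]
  simp only [Polynomial.eval_comp, Polynomial.eval_add, Polynomial.eval_X, Polynomial.eval_ofNat]
  omega

theorem abs_acceptProb_simulation_sub_le {Φ : Scheme} {S : PPT} {b u : Polynomial ℕ}
    (hcoins : S.coins = b * u + Φ.setupCoins)
    (hS : ∀ (κ : ℕ) (r : Fin (2 ^ S.coins.eval κ)) {n : ℕ} (C : Finset (Option (Fin n))) (t : ℕ)
      (x : Fin n → ℤ) (ρ : Fin (2 ^ Φ.setupCoins.eval κ)),
      (ρ : ℕ) = r % 2 ^ Φ.setupCoins.eval κ →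
      S.output κ r (.ofList [num t, .ofInt (∑ ν, x ν), Scheme.encodeCoalition C,
        Scheme.coalitionInputs C x]) =
      viewValue Φ (Φ.setup κ ρ)
        (simPads n (2 ^ b.eval κ) (r / 2 ^ Φ.setupCoins.eval κ) (Φ.setup κ ρ)) C t x
        (standIn C x)) (C : Φ.Coalition) (t : ℕ → ℕ) (x : (κ : ℕ) → Fin (Φ.users κ) → ℤ)
    (D : NonuniformPPT) (κ : ℕ) (hu : Φ.users κ * Φ.users κ ≤ u.eval κ) {ε : ℝ}
    (hq : ∀ ρ, (Φ.setup κ ρ).q ≤ 2 ^ b.eval κ)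
    (hε : ∀ ρ, (Φ.users κ * Φ.users κ : ℝ) * ((Φ.setup κ ρ).q / (2 ^ b.eval κ : ℕ)) ≤ ε) :
    |D.acceptProb κ (Φ.simulation S C t (fun κ => ∑ ν, x κ ν) x κ) -
      D.acceptProb κ (viewWith C t x (fun κ => standIn (C κ) (x κ)) κ)| ≤ ε := by
  rw [acceptProb_viewWith, Scheme.simulation, PPT.dist, D.acceptProb_uniform_map]
  -- The value `0` is a default; the remainder is always in range.
  let g : ℕ → ℕ → ℝ := fun ρ r =>
    if h : ρ < 2 ^ Φ.setupCoins.eval κ then D.acceptProb κ (PMF.pure (viewValue Φ (Φ.setup κ ⟨ρ, h⟩)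
      (simPads (Φ.users κ) (2 ^ b.eval κ) r (Φ.setup κ ⟨ρ, h⟩)) (C κ) (t κ) (x κ)
        (standIn (C κ) (x κ)))) else 0
  have hA : 0 < 2 ^ Φ.setupCoins.eval κ := by positivity
  have h := abs_expect_digitMod_sub_le (K := 2 ^ S.coins.eval κ) hA
    (by rw [hcoins, ← pow_mul, ← pow_add]; simp) hu (q := fun ρ => (Φ.setup κ ρ).q)
    (fun ρ => (Φ.setup κ ρ).q_pos) ε hq hε (fun ρ s => D.acceptProb κ
      (PMF.pure (viewValue Φ (Φ.setup κ ρ) s (C κ) (t κ) (x κ) (standIn (C κ) (x κ)))))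
    (fun _ _ => D.acceptProb_nonneg κ _) (fun _ _ => D.acceptProb_le_one κ _) g
    (fun ρ r => dif_pos ρ.2)
  convert h using 4 with r
  have hlt : (r : ℕ) % 2 ^ Φ.setupCoins.eval κ < 2 ^ Φ.setupCoins.eval κ := Nat.mod_lt _ hA
  simp only [g]
  rw [dif_pos hlt, hS κ r (C κ) (t κ) (x κ) ⟨_, hlt⟩ rfl]

end Feddy

end

theorem theorem3 (Φ : Feddy.Scheme) (hmask : Φ.IsINDCPA)
    (C : Φ.Coalition) (hC : Φ.IsLogSize C) :
    Φ.IsPrivateFor Set.univ C := by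
  open Feddy in
  intro f _
  obtain ⟨Q, hQ⟩ := exists_q_bound Φ
  obtain ⟨U, hU⟩ := Φ.users_bounded
  -- Digits of `κ + Q` bits give `q / B ≤ 2 ^ (-κ)`, and `U * U` bounds the number of pads.
  obtain ⟨S, hcoins, hS⟩ := exists_simulator Φ (Polynomial.X + Q) (U * U)
  refine ⟨S, fun t ht x hx D => ?_⟩
  have hx' : ∀ κ ν, |x κ ν| < 2 ^ f.bits κ := fun κ ν => hx κ ν
  have hreal := compIndist_viewWith hmask hC ht (x := x)
    -- The bit bound is `n` plus the length of the inputs, since `n * 2 ^ bits < 2 ^ (n + bits)`.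
    (y := fun κ => standIn (C κ) (x κ)) (Φ.users_bounded.add f.bits_bounded)
    (fun κ ν => (hx' κ ν).trans_le (pow_le_pow_right₀ one_le_two (Nat.le_add_left _ _)))
    (fun κ ν => (abs_standIn_le _ (fun ν => (hx' κ ν).le) ν).trans_lt (by
      rw [pow_add]
      exact mul_lt_mul_of_pos_right (by exact_mod_cast Nat.lt_two_pow_self) (by positivity)))
    (fun κ => sum_standIn _ _) (fun κ ν h => standIn_of_mem _ h) D
  have hstat : ∀ κ, |D.acceptProb κ (Φ.simulation S C t (fun κ => f.eval κ (x κ)) x κ) -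
      D.acceptProb κ (viewWith C t x (fun κ => standIn (C κ) (x κ)) κ)| ≤
        (((U * U).eval κ : ℕ) : ℝ) / 2 ^ κ := by
    intro κ
    have hUU : Φ.users κ * Φ.users κ ≤ (U * U).eval κ := by
      rw [Polynomial.eval_mul]; exact Nat.mul_le_mul (hU κ) (hU κ)
    have hb : (Polynomial.X + Q).eval κ = κ + Q.eval κ := by simp
    refine abs_acceptProb_simulation_sub_le hcoins hS C t x D κ hUU (fun ρ => ?_) fun ρ => ?_
    · rw [hb]
      exact (hQ κ ρ).le.trans (Nat.pow_le_pow_right two_pos (Nat.le_add_left _ _))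
    · have h1 : ((Φ.setup κ ρ).q : ℝ) ≤ 2 ^ Q.eval κ := by exact_mod_cast (hQ κ ρ).le
      have h2 : ((Φ.setup κ ρ).q / (2 ^ (Polynomial.X + Q).eval κ : ℕ) : ℝ) ≤ 1 / 2 ^ κ := by
        rw [hb]
        push_cast
        rw [pow_add, div_le_div_iff₀ (by positivity) (by positivity), one_mul, mul_comm]
        exact mul_le_mul_of_nonneg_left h1 (by positivity)
      rw [div_eq_mul_one_div (((U * U).eval κ : ℕ) : ℝ)]
      exact mul_le_mul (by exact_mod_cast hUU) h2 (by positivity) (Nat.cast_nonneg _)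
  refine ((negligible_polynomial_div_two_pow (U * U)).add hreal).trans_abs_le fun κ => ?_
  rw [abs_abs]
  refine le_trans ?_ (le_abs_self _)
  exact (abs_sub_le _ _ _).trans (add_le_add_left (hstat κ) _)
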